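/- Let $V,W$ be (real) Banach spaces, $T>0$, $\alpha\in(\frac13,\frac12)$. Let $\mathbf X=(X,\mathbb X)$ be an $\alpha$-Hölder rough path over $V$ on $[0,T]$, i.e. $X:[0,T]\to V$, $\mathbb X:[0,T]^2\to V\otimes V$ (completed projective tensor product), with $$\|X\|_\alpha=\sup_{s\ne t}\frac{|X_t-X_s|}{|t-s|^\alpha}<\infty,\qquad \|\mathbb X\|_{2\alpha}=\sup_{s\neq t}\frac{|\mathbb X_{s,t}|}{|t-s|^{2\alpha}}<\infty,$$ and $\mathbb X_{s,t}-\mathbb X_{s,u}-\mathbb X_{u,t}=(X_u-X_s)\otimes(X_t-X_u)$ for all $s,u,t\in[0,T]$. Let $A$ be the generator of a $C_0$-semigroup $(S_t)_{t\ge0}$ on $W$ with $|S_t|\le Me^{\omega t}$ for all $t\ge 0$, where $M\ge1$ and $\omega\in\mathbb R$. The spaces $D(A^n)$ carry the graph norms $|y|_{D(A^n)}=|y|+\sum_{j=1}^n|A^jy|$. Let $f_0:[0,T]\times W\to D(A)$ be continuous, and Lipschitz in the second variable uniformly in time, with $$\|f_0\|_{\mathrm{Lip}}=\sup_t|f_0(t,0)|_{D(A)}+\sup_t\sup_{y\ne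 z}\frac{|f_0(t,y)-f_0(t,z)|_{D(A)}}{|y-z|}.$$ Let $f\in C_b^{2\alpha,2}([0,T]\times W,L(V,D(A^2)))$, i.e. $f(t,\cdot)$ is twice continuously Fréchet differentiable for every $t\in[0,T]$ and $$\|f\|_{C_b^{2\alpha,2}}=\sup_{t\in[0,T]}\sum_{k=0}^2\sup_{y}|D_y^kf(t,y)|+\sum_{k=0}^{1}\sup_{y}\|D_y^kf(\cdot,y)\|_{2\alpha}<\infty .$$ A global mild solution of $$dY_t=(AY_t+f_0(t,Y_t))\,dt+f(t,Y_t)\,d\mathbf X_t,\qquad Y_0=\xi\in D(A),$$ is a pair $(Y,Y')$ of $\alpha$-Hölder paths $Y:[0,T]\to W$, $Y':[0,T]\to L(V,W)$ such that $R^Y_{s,t}=Y_t-Y_s-Y'_s(X_t-X_s)$ satisfies $\|R^Y\|_{2\alpha}<\infty$, such that $Y'_t=f(t,Y_t)$ for all $t\in[0,T]$, and such that $$Y_t=S_t\xi+\int_0^tS_{t-s}f_0(s,Y_s)\,ds+\int_0^tS_{t-s}f(s,Y_s)\,d\mathbf X_s,\qquad t\in[0,T].$$ The last integral is the rough integral of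 the controlled path $(Z,Z')$ with $Z_s=S_{t-s}f(s,Y_s)$ and $Z'_s=S_{t-s}D_yf(s,Y_s)Y'_s$, i.e. the limit of $\sum_{[u,v]\in\Pi}\big(Z_u(X_v-X_u)+Z'_u\mathbb X_{u,v}\big)$ over partitions $\Pi$ of $[0,t]$ as their mesh tends to $0$. Then there is a constant $K>0$, depending only on $\xi$ (through $|\xi|_{D(A)}$), $\alpha$, $T$, $\mathbf X$ (and the spaces $V,W$), $\|f_0\|_{\mathrm{Lip}}$, $\|f\|_{C_b^{2\alpha,2}}$ and $M,\omega$, such that every global mild solution $(Y,Y')$ with $Y_0=\xi$ satisfies $$|Y_t|\le K\qquad\text{for all }t\in[0,T].$$ More precisely, for given $V,W,\alpha,T,\mathbf X,M,\omega$ and $r,L_0,L\ge0$, one $K$ serves for all such semigroups and all $\xi,f_0,f$ with $|\xi|_{D(A)}\le r$, $\|f_0\|_{\mathrm{Lip}}\le L_0$, $\|f\|_{C_b^{2\alpha,2}}\le L$. -/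

import Mathlib

open scoped ENNReal NNReal Topology TensorProduct
open Set Filter

noncomputable section

/-! ### The completed projective tensor product -/

section Tensor

variable (V : Type*) [NormedAddCommGroup V] [NormedSpace ℝ V]

/-- The Banach space `V ⊗ V`: the completion of the algebraic tensor product with respect to the
projective norm `‖x‖ = inf {∑ ‖vᵢ‖ ‖wᵢ‖ : x = ∑ vᵢ ⊗ wᵢ}`. This is the tensor norm for which
`L(V, L(V, W))` embeds into `L(V ⊗ V, W)` for every Banach space `W`. -/
abbrev TensorSq : Type _ := UniformSpace.Completion (⨂[ℝ] _ : Fin 2, V)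

variable {V}

/-- The elementary tensor `v ⊗ w`. -/
def tensorMk (v w : V) : TensorSq V :=
  ((PiTensorProduct.tprod ℝ ![v, w] : ⨂[ℝ] _ : Fin 2, V) : TensorSq V)

variable {W : Type*} [NormedAddCommGroup W] [NormedSpace ℝ W]

/-- A continuous bilinear map, seen as a continuous multilinear map in two variables. -/
def bilinToMultilinear (B : V →L[ℝ] V →L[ℝ] W) :
    ContinuousMultilinearMap ℝ (fun _ : Fin 2 => V) W where
  toFun m := B (m 0) (m 1)
  map_update_add' m i x y := by
    fin_cases i <;> simp
  map_update_smul' m i c x := by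
    fin_cases i <;> simp
  cont := by fun_prop

/-- The embedding `L(V, L(V, W)) → L(V ⊗ V, W)`. -/
def tensorLift [CompleteSpace W] (B : V →L[ℝ] V →L[ℝ] W) : TensorSq V →L[ℝ] W :=
  (PiTensorProduct.liftIsometry ℝ (fun _ : Fin 2 => V) W (bilinToMultilinear B)).extend
    (UniformSpace.Completion.toComplL : (⨂[ℝ] _ : Fin 2, V) →L[ℝ] TensorSq V)

theorem tensorLift_tensorMk [CompleteSpace W] (B : V →L[ℝ] V →L[ℝ] W) (v w : V) :
    tensorLift B (tensorMk v w) = B v w := by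
  have h := ContinuousLinearMap.extend_eq
    (PiTensorProduct.liftIsometry ℝ (fun _ : Fin 2 => V) W (bilinToMultilinear B))
    (e := (UniformSpace.Completion.toComplL : (⨂[ℝ] _ : Fin 2, V) →L[ℝ] TensorSq V))
    UniformSpace.Completion.denseRange_coe
    (UniformSpace.Completion.isUniformInducing_coe _)
    (PiTensorProduct.tprod ℝ ![v, w])
  exact h.trans (by simp [bilinToMultilinear])

theorem norm_tensorLift_le [CompleteSpace W] (B : V →L[ℝ] V →L[ℝ] W) : ‖tensorLift B‖ ≤ ‖B‖ := by
  refine ContinuousLinearMap.opNorm_le_bound _ (norm_nonneg B) fun x => ?_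
  induction x using UniformSpace.Completion.induction_on with
  | hp => exact isClosed_le (by fun_prop) (by fun_prop)
  | ih x =>
    have h : tensorLift B (x : TensorSq V) =
      PiTensorProduct.liftIsometry ℝ (fun _ : Fin 2 => V) W (bilinToMultilinear B) x :=
      ContinuousLinearMap.extend_eq
        (PiTensorProduct.liftIsometry ℝ (fun _ : Fin 2 => V) W (bilinToMultilinear B))
        (e := (UniformSpace.Completion.toComplL : (⨂[ℝ] _ : Fin 2, V) →L[ℝ] TensorSq V))
        UniformSpace.Completion.denseRange_coe
        (UniformSpace.Completion.isUniformInducing_coe _) x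
    rw [h, UniformSpace.Completion.norm_coe]
    refine (ContinuousLinearMap.le_opNorm _ _).trans ?_
    rw [LinearIsometryEquiv.norm_map]
    gcongr
    refine ContinuousMultilinearMap.opNorm_le_bound (norm_nonneg B) fun m => ?_
    refine (B.le_opNorm₂ (m 0) (m 1)).trans_eq ?_
    rw [Fin.prod_univ_two, mul_assoc]

end Tensor

/-! ### Hölder seminorms, rough paths, controlled rough paths -/

section RoughPaths

variable {E : Type*} [NormedAddCommGroup E]

/-- The seminorm `‖F‖_γ = sup_{s ≠ t} |F_{s,t}| / |t - s|^γ` of a two-parameter function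
on `[0,T]²`. -/
def holderNorm₂ (T γ : ℝ) (F : ℝ → ℝ → E) : ℝ≥0∞ :=
  ⨆ s ∈ Icc 0 T, ⨆ t ∈ Icc 0 T, ⨆ _ : s ≠ t, ‖F s t‖ₑ / ENNReal.ofReal (|t - s| ^ γ)

/-- The Hölder seminorm `‖X‖_γ = sup_{s ≠ t} |X_t - X_s| / |t - s|^γ` of a path on `[0,T]`. -/
def holderNorm (T γ : ℝ) (X : ℝ → E) : ℝ≥0∞ :=
  holderNorm₂ T γ fun s t => X t - X s

variable {V W : Type*} [NormedAddCommGroup V] [NormedSpace ℝ V]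
  [NormedAddCommGroup W] [NormedSpace ℝ W]

/-- An `α`-Hölder rough path `(X, 𝕏)` over `V` on `[0,T]`. -/
structure RoughPath (V : Type*) [NormedAddCommGroup V] [NormedSpace ℝ V] (T α : ℝ) where
  /-- the path `X` -/
  path : ℝ → V
  /-- the second order process `𝕏` -/
  area : ℝ → ℝ → TensorSq V
  holder_path : holderNorm T α path < ∞
  holder_area : holderNorm₂ T (2 * α) area < ∞
  chen : ∀ s ∈ Icc 0 T, ∀ u ∈ Icc 0 T, ∀ t ∈ Icc 0 T,
    area s t - area s u - area u t = tensorMk (path u - path s) (path t - path u)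

/-- `(Y, Y')` is a path controlled by `X` on `[0,T]`, that is, it belongs to `𝒟_X^{2α}([0,T], W)`:
`Y` and `Y'` are `α`-Hölder and the remainder `R_{s,t} = Y_t - Y_s - Y'_s (X_t - X_s)` has finite
`2α`-Hölder seminorm. -/
def IsControlled (T α : ℝ) (X : ℝ → V) (Y : ℝ → W) (Y' : ℝ → V →L[ℝ] W) : Prop :=
  holderNorm T α Y < ∞ ∧ holderNorm T α Y' < ∞ ∧
    holderNorm₂ T (2 * α) (fun s t => Y t - Y s - Y' s (X t - X s)) < ∞

/-- `I` is the rough integral `∫_a^b Z_s d𝐗_s`: the limit, as the mesh of the partition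
`a = τ₀ < τ₁ < … < τₙ = b` tends to zero, of the compensated Riemann sums
`∑ (Z_u X_{u,v} + Z'_u 𝕏_{u,v})` over the partition intervals `[u,v]`. -/
def HasRoughIntegral [CompleteSpace W] {T α : ℝ} (X : RoughPath V T α)
    (Z : ℝ → V →L[ℝ] W) (Z' : ℝ → V →L[ℝ] V →L[ℝ] W) (a b : ℝ) (I : W) : Prop :=
  ∀ ε > 0, ∃ δ > 0, ∀ (n : ℕ) (τ : ℕ → ℝ), τ 0 = a → τ n = b →
    (∀ i < n, τ i < τ (i + 1) ∧ τ (i + 1) - τ i < δ) →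
    ‖∑ i ∈ Finset.range n, (Z (τ i) (X.path (τ (i + 1)) - X.path (τ i)) +
        tensorLift (Z' (τ i)) (X.area (τ i) (τ (i + 1)))) - I‖ < ε

end RoughPaths

/-! ### Strongly continuous semigroups and domains of their generators -/

section Semigroups

/-- A strongly continuous semigroup `(S_t)_{t ≥ 0}` on `W`; the values at negative times carry
no information. -/
structure C0Semigroup (W : Type*) [NormedAddCommGroup W] [NormedSpace ℝ W] where
  /-- the operators `S_t` -/
  op : ℝ → W →L[ℝ] W
  op_zero : op 0 = ContinuousLinearMap.id ℝ W
  op_add : ∀ s ≥ 0, ∀ t ≥ 0, op (s + t) = (op s).comp (op t)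
  tendsto_op : ∀ y, Tendsto (fun t => op t y) (𝓝[>] 0) (𝓝 y)

variable {W : Type*} [NormedAddCommGroup W] [NormedSpace ℝ W]

namespace C0Semigroup

/-- `lim_{h ↓ 0} (S_h y - y) / h = z`. -/
def HasGenerator (S : C0Semigroup W) (y z : W) : Prop :=
  Tendsto (fun h : ℝ => h⁻¹ • (S.op h y - y)) (𝓝[>] 0) (𝓝 z)

theorem HasGenerator.add {S : C0Semigroup W} {y z y' z' : W} (h : S.HasGenerator y z)
    (h' : S.HasGenerator y' z') : S.HasGenerator (y + y') (z + z') := by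
  refine (Tendsto.add h h').congr fun t => ?_
  rw [map_add, ← smul_add]
  congr 1
  abel

theorem HasGenerator.smul {S : C0Semigroup W} {y z : W} (c : ℝ) (h : S.HasGenerator y z) :
    S.HasGenerator (c • y) (c • z) := by
  refine (Tendsto.const_smul h c).congr fun t => ?_
  rw [map_smul, ← smul_sub, smul_comm]

theorem HasGenerator.zero (S : C0Semigroup W) : S.HasGenerator 0 0 := by
  simp [HasGenerator]

theorem HasGenerator.unique {S : C0Semigroup W} {y z z' : W} (h : S.HasGenerator y z)
    (h' : S.HasGenerator y z') : z = z' :=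
  tendsto_nhds_unique h h'

/-- The infinitesimal generator `A : D(A) → W`, `A y = lim_{h ↓ 0} (S_h y - y) / h`, defined on
the set `D(A)` of those `y` for which the limit exists. -/
def generator (S : C0Semigroup W) : W →ₗ.[ℝ] W where
  domain :=
    { carrier := {y | ∃ z, S.HasGenerator y z}
      add_mem' := fun ⟨z, hz⟩ ⟨z', hz'⟩ => ⟨z + z', hz.add hz'⟩
      zero_mem' := ⟨0, HasGenerator.zero S⟩
      smul_mem' := fun c _ ⟨z, hz⟩ => ⟨c • z, hz.smul c⟩ }
  toFun :=
    { toFun := fun y => y.2.choose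
      map_add' := fun x y =>
        (x + y).2.choose_spec.unique (x.2.choose_spec.add y.2.choose_spec)
      map_smul' := fun c x => (c • x).2.choose_spec.unique (x.2.choose_spec.smul c) }

theorem mem_graph_generator (S : C0Semigroup W) (y z : W) :
    (y, z) ∈ S.generator.graph ↔ S.HasGenerator y z := by
  rw [LinearPMap.mem_graph_iff]
  constructor
  · rintro ⟨x, rfl, rfl⟩
    exact x.2.choose_spec
  · intro h
    exact ⟨⟨y, z, h⟩, rfl, (Exists.choose_spec (⟨z, h⟩ : ∃ z, S.HasGenerator y z)).unique h⟩

/-- The normed space `D(Aⁿ)` with the graph norm `|y| + ∑_{j=1}^n |A^j y|`. An element `y` of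
`D(Aⁿ)` is represented by the tuple `(y, A y, …, Aⁿ y)`, which it determines; the graph norm is
then the `ℓ¹`-norm of the tuple. -/
def domPow (S : C0Semigroup W) (n : ℕ) : Submodule ℝ (PiLp 1 fun _ : Fin (n + 1) => W) where
  carrier := {v | ∀ i : Fin n, (v i.castSucc, v i.succ) ∈ S.generator.graph}
  add_mem' := fun {v w} hv hw i => by simpa using S.generator.graph.add_mem (hv i) (hw i)
  zero_mem' := fun _ => by simp
  smul_mem' := fun c v hv i => by simpa using S.generator.graph.smul_mem c (hv i)

/-- The inclusion `D(Aⁿ) → W`. -/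
def incl (S : C0Semigroup W) (n : ℕ) : S.domPow n →L[ℝ] W :=
  (PiLp.proj 1 (fun _ : Fin (n + 1) => W) 0).comp (S.domPow n).subtypeL

end C0Semigroup

end Semigroups

/-! ### Coefficients -/

section Coefficients

variable {E F : Type*} [NormedAddCommGroup E] [NormedSpace ℝ E]
  [NormedAddCommGroup F] [NormedSpace ℝ F]

/-- `f₀ ∈ Lip([0,T] × E, F)`: `f₀` is continuous on `[0,T] × E` and Lipschitz in the second
variable, uniformly in time. -/
def IsLip (T : ℝ) (f₀ : ℝ → E → F) : Prop :=
  ContinuousOn (fun p : ℝ × E => f₀ p.1 p.2) (Icc 0 T ×ˢ univ) ∧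
    ∃ L > 0, ∀ t ∈ Icc 0 T, ∀ y z, ‖f₀ t y - f₀ t z‖ ≤ L * ‖y - z‖

/-- `‖f₀‖_Lip = sup_t |f₀(t,0)| + sup_t |f₀(t,·)|_Lip`. -/
def lipNorm (T : ℝ) (f₀ : ℝ → E → F) : ℝ≥0∞ :=
  (⨆ t ∈ Icc 0 T, ‖f₀ t 0‖ₑ) +
    ⨆ t ∈ Icc 0 T, ⨆ y, ⨆ z, ⨆ _ : y ≠ z, ‖f₀ t y - f₀ t z‖ₑ / ‖y - z‖ₑ

/-- `‖f‖_{C_b^{γ,n}} = sup_t ∑_{k ≤ n} sup_y |D_y^k f(t,y)| + ∑_{k < n} sup_y ‖D_y^k f(·,y)‖_γ`. -/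
def cbNorm (T γ : ℝ) (n : ℕ) (f : ℝ → E → F) : ℝ≥0∞ :=
  (⨆ t ∈ Icc 0 T, ∑ k ∈ Finset.range (n + 1), ⨆ y, ‖iteratedFDeriv ℝ k (f t) y‖ₑ) +
    ∑ k ∈ Finset.range n, ⨆ y, holderNorm T γ fun t => iteratedFDeriv ℝ k (f t) y

/-- `f ∈ C_b^{γ,n}([0,T] × E, F)`. -/
def IsCb (T γ : ℝ) (n : ℕ) (f : ℝ → E → F) : Prop :=
  (∀ t ∈ Icc 0 T, ContDiff ℝ n (f t)) ∧ cbNorm T γ n f < ∞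

end Coefficients

/-! ### Mild solutions -/

section Mild

variable {V W : Type*} [NormedAddCommGroup V] [NormedSpace ℝ V]
  [NormedAddCommGroup W] [NormedSpace ℝ W] [CompleteSpace W]

/-- `(Y, Y')` is a global mild solution on `[0,T]` of
`dY_t = (A Y_t + f₀(t, Y_t)) dt + f(t, Y_t) d𝐗_t`, `Y_0 = ξ`: it is a path controlled by `X` with
`Y' = f(Y)`, and for all `t ∈ [0,T]`
`Y_t = S_t ξ + ∫_0^t S_{t-s} f₀(s, Y_s) ds + ∫_0^t S_{t-s} f(s, Y_s) d𝐗_s`.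
The rough integral is that of the controlled path `s ↦ S_{t-s} f(s, Y_s)`, whose derivative is
`s ↦ S_{t-s} f(Y)'_s` with `f(Y)'_s = D_y f(s, Y_s) Y'_s`. -/
def IsMildSolution {T α : ℝ} (X : RoughPath V T α) (S : C0Semigroup W) (ξ : S.domPow 1)
    (f₀ : ℝ → W → S.domPow 1) (f : ℝ → W → V →L[ℝ] S.domPow 2)
    (Y : ℝ → W) (Y' : ℝ → V →L[ℝ] W) : Prop :=
  IsControlled T α X.path Y Y' ∧
  (∀ t ∈ Icc 0 T, Y' t = (S.incl 2).comp (f t (Y t))) ∧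
  ∀ t ∈ Icc 0 T, ∃ N : W,
    HasRoughIntegral X
      (fun s => ((S.op (t - s)).comp (S.incl 2)).comp (f s (Y s)))
      (fun s => (ContinuousLinearMap.compL ℝ V (S.domPow 2) W
          ((S.op (t - s)).comp (S.incl 2))).comp ((fderiv ℝ (f s) (Y s)).comp (Y' s)))
      0 t N ∧
    Y t = S.op t (S.incl 1 ξ) + (∫ s in (0 : ℝ)..t, S.op (t - s) (S.incl 1 (f₀ s (Y s)))) + N

end Mild

end

/-!
The remainder `R_{s,t} = Y_t - Y_s - Y'_s X_{s,t}` of a mild solution satisfies a linear estimate,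
and this is what makes a global bound possible. Taylor expansion of `f` seems to make the
remainder of `f(Y)` quadratic in `Y`, but the increment of `Y` splits as `Y'_s X_{s,t} + R_{s,t}`.
The first part is bounded by the data alone, since `Y' = f(Y)` is bounded; the quadratic Taylor
error is needed only along it, and along `R` the Lipschitz bound on `f` suffices. Hence
`|R^Y| ≤ ρ |t-s|^{2α}` implies `|R^{f(Y)}| ≤ C (1 + ρ) |t-s|^{2α}`
(`IsCoeffControlled.norm_coeff_remainder_le`).

The sewing estimate (`norm_dyadicSum_sub_le`) then bounds the compensated Riemann sums of
`∫ P_u f(u, Y_u) d𝐗_u`, for a Lipschitz family `P` of operators, linearly in `ρ` and in the size of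
`P` (`IsCoeffControlled.norm_dyadicSum_operatorGerm_sub_le`). Only the uniform bound on dyadic sums
is used; their convergence is part of the definition of a mild solution.

The increment over `[s,t]` of the rough convolution is the integral of `S_{t-u} f(u, Y_u)`
over `[s,t]` plus that of `(S_{t-u} - S_{s-u}) f(u, Y_u)` over `[0,s]`. As `f` takes values in
`D(A²)`, the latter family of operators and its Lipschitz constant in `u` are of order `t - s`
(`C0Semigroup.norm_op_sub_op_sub_incl_le`), which is better than the required order `2α < 1`. The
initial value and the drift, with values in `D(A)`, also contribute increments of order `t - s`.

Suppose that `K` bounds `|Y|` and the remainder on `[0,τ]`, and that `ρ` bounds the remainder on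
`[τ,τ+η]`. Then `C (1 + K) + C η^α ρ` also bounds the latter
(`IsBoundedMild.remainderBound_improve`). For `η` small, depending on the data but not on `K`, the
last term is absorbed, so that the bounds extend to `[0,τ+η]` with a constant depending on `K` and
the data (`IsBoundedMild.bounds_extend`). Finitely many steps cover `[0,T]`.
-/

noncomputable section

/-! ### Dyadic Riemann sums and the sewing estimate -/

section Sewing

variable {E : Type*} [NormedAddCommGroup E]

/-- The Riemann sum of a two-parameter function `Ξ` over the partition of `[a,b]` into `2 ^ m`
intervals of equal length, defined by repeated bisection. -/
def dyadicSum (Ξ : ℝ → ℝ → E) : ℕ → ℝ → ℝ → E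
  | 0, a, b => Ξ a b
  | m + 1, a, b => dyadicSum Ξ m a ((a + b) / 2) + dyadicSum Ξ m ((a + b) / 2) b

theorem dyadicSum_sub {Ξ Ξ' Ξ'' : ℝ → ℝ → E} (h : ∀ u v, Ξ'' u v = Ξ u v - Ξ' u v) (m : ℕ)
    (a b : ℝ) : dyadicSum Ξ'' m a b = dyadicSum Ξ m a b - dyadicSum Ξ' m a b := by
  induction m generalizing a b with
  | zero => exact h a b
  | succ m ih => simp only [dyadicSum, ih]; abel

/-- The sewing estimate. Bisection gains the factor `2 * (1 / 2) ^ θ = 2 ^ (1 - θ) < 1` at each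
level, so that the constant is that of a geometric series. -/
theorem norm_dyadicSum_sub_le {Ξ : ℝ → ℝ → E} {θ K a b : ℝ} (hθ : 1 < θ) (hK : 0 ≤ K)
    (hab : a ≤ b)
    (hδ : ∀ u w v, a ≤ u → u ≤ w → w ≤ v → v ≤ b →
      ‖Ξ u v - Ξ u w - Ξ w v‖ ≤ K * (v - u) ^ θ) (m : ℕ) :
    ‖dyadicSum Ξ m a b - Ξ a b‖ ≤ (1 - 2 ^ (1 - θ))⁻¹ * K * (b - a) ^ θ := by
  have h2 : (2 : ℝ) ^ (1 - θ) < 1 :=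
    Real.rpow_lt_one_of_one_lt_of_neg one_lt_two (by linarith)
  set g : ℝ := (2 : ℝ) ^ (1 - θ) with hg
  have hg1 : 0 < 1 - g := by linarith
  induction m generalizing a b with
  | zero =>
    simp only [dyadicSum, sub_self, norm_zero]
    have : 0 ≤ (b - a) ^ θ := Real.rpow_nonneg (by linarith) _
    positivity
  | succ m ih =>
    have hac : a ≤ (a + b) / 2 := by linarith
    have hcb : (a + b) / 2 ≤ b := by linarith
    have h1 := ih hac fun u w v h1 h2 h3 h4 => hδ u w v h1 h2 h3 (h4.trans hcb)
    have h2 := ih hcb fun u w v h1 h2 h3 h4 => hδ u w v (hac.trans h1) h2 h3 h4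
    have h3 := hδ a ((a + b) / 2) b le_rfl hac hcb le_rfl
    have hhalf : ∀ x : ℝ, x = 2⁻¹ * (b - a) → x ^ θ = g / 2 * (b - a) ^ θ := by
      rintro x rfl
      rw [Real.mul_rpow (by norm_num) (by linarith), hg, Real.rpow_sub two_pos, Real.rpow_one,
        Real.inv_rpow two_pos.le]
      congr 1
      field_simp
    rw [hhalf _ (by ring)] at h1 h2
    set q := (b - a) ^ θ
    set c := (1 - g)⁻¹ with hc
    have hcg : c * (1 - g) = 1 := inv_mul_cancel₀ hg1.ne'
    have heq : dyadicSum Ξ (m + 1) a b - Ξ a b =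
        (dyadicSum Ξ m a ((a + b) / 2) - Ξ a ((a + b) / 2)) +
        (dyadicSum Ξ m ((a + b) / 2) b - Ξ ((a + b) / 2) b) -
        (Ξ a b - Ξ a ((a + b) / 2) - Ξ ((a + b) / 2) b) := by
      simp only [dyadicSum]; abel
    rw [heq]
    refine (norm_sub_le _ _).trans ?_
    refine (add_le_add (norm_add_le _ _) le_rfl).trans ?_
    calc _ ≤ c * K * (g / 2 * q) + c * K * (g / 2 * q) + K * q := by gcongr
      _ = c * K * g * q + (c * (1 - g)) * K * q := by rw [hcg]; ring
      _ = c * K * q := by ring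

/-- `v` is the sum of `Ξ` over a strictly increasing partition of `[a,b]` of mesh less than `δ`. -/
inductive IsRiemannSum (Ξ : ℝ → ℝ → E) (δ a : ℝ) : ℝ → E → Prop
  | nil : IsRiemannSum Ξ δ a a 0
  | snoc {b c : ℝ} {v : E} (h : IsRiemannSum Ξ δ a b v) (hbc : b < c) (hδ : c - b < δ) :
      IsRiemannSum Ξ δ a c (v + Ξ b c)

theorem IsRiemannSum.trans {Ξ : ℝ → ℝ → E} {δ a b c : ℝ} {v w : E}
    (h : IsRiemannSum Ξ δ a b v) (h' : IsRiemannSum Ξ δ b c w) :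
    IsRiemannSum Ξ δ a c (v + w) := by
  induction h' with
  | nil => simpa using h
  | snoc _ hbc hδ ih => rw [← add_assoc]; exact ih.snoc hbc hδ

theorem IsRiemannSum.exists_partition {Ξ : ℝ → ℝ → E} {δ a b : ℝ} {v : E}
    (h : IsRiemannSum Ξ δ a b v) : ∃ (n : ℕ) (τ : ℕ → ℝ), τ 0 = a ∧ τ n = b ∧
      (∀ i < n, τ i < τ (i + 1) ∧ τ (i + 1) - τ i < δ) ∧
      v = ∑ i ∈ Finset.range n, Ξ (τ i) (τ (i + 1)) := by
  induction h with
  | nil => exact ⟨0, fun _ => a, rfl, rfl, by simp, by simp⟩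
  | @snoc b c v _ hbc hδ ih =>
    obtain ⟨n, τ, h0, hn, hτ, rfl⟩ := ih
    refine ⟨n + 1, Function.update τ (n + 1) c, ?_, by simp, fun i hi => ?_, ?_⟩
    · rw [Function.update_of_ne (by omega), h0]
    · rcases Nat.lt_succ_iff_lt_or_eq.mp hi with h | rfl
      · rw [Function.update_of_ne (by omega), Function.update_of_ne (by omega)]
        exact hτ i h
      · rw [Function.update_of_ne (by omega), Function.update_self, hn]
        exact ⟨hbc, hδ⟩
    · rw [Finset.sum_range_succ, Function.update_self, Function.update_of_ne (by omega), hn]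
      congr 1
      refine Finset.sum_congr rfl fun i hi => ?_
      have := Finset.mem_range.mp hi
      rw [Function.update_of_ne (by omega), Function.update_of_ne (by omega)]

theorem isRiemannSum_dyadicSum {Ξ : ℝ → ℝ → E} {δ a b : ℝ} (m : ℕ) (hab : a ≤ b)
    (h0 : ∀ u ∈ Icc a b, Ξ u u = 0) (hδ : b - a < δ * 2 ^ m) :
    IsRiemannSum Ξ δ a b (dyadicSum Ξ m a b) := by
  induction m generalizing a b with
  | zero =>
    rcases hab.eq_or_lt with rfl | h
    · simpa [dyadicSum, h0] using IsRiemannSum.nil (Ξ := Ξ) (δ := δ) (a := a)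
    · simpa [dyadicSum] using IsRiemannSum.nil.snoc (Ξ := Ξ) h (by simpa using hδ)
  | succ m ih =>
    rw [pow_succ] at hδ
    exact (ih (by linarith) (fun u hu => h0 u ⟨hu.1, by linarith [hu.2]⟩) (by linarith)).trans
      (ih (by linarith) (fun u hu => h0 u ⟨by linarith [hu.1], hu.2⟩) (by linarith))

theorem dyadicSum_self_eq_zero {Ξ : ℝ → ℝ → E} {a : ℝ} (h : Ξ a a = 0) (m : ℕ) :
    dyadicSum Ξ m a a = 0 := by
  induction m with
  | zero => exact h
  | succ m ih => simp [dyadicSum, ih]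

/-- Comparison of the limits `N` over `[0,t]` and `N'` over `[0,s]` of the dyadic sums of two germs:
on `[0,s]`, cut at `τ`, only the difference `H` of the germs enters. -/
theorem norm_limit_sub_limit_le {G G' H : ℝ → ℝ → E} (hH : ∀ u v, H u v = G u v - G' u v)
    {τ s t e₁ e₂ e₃ : ℝ} {N N' x : E} (hG' : G' s s = 0)
    (hN : Tendsto (fun m => dyadicSum G m 0 τ + dyadicSum G m τ s + dyadicSum G m s t)
      atTop (𝓝 N))
    (hN' : Tendsto (fun m => dyadicSum G' m 0 τ + dyadicSum G' m τ s + dyadicSum G' m s s)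
      atTop (𝓝 N'))
    (h₁ : ∀ m, ‖dyadicSum H m 0 τ‖ ≤ e₁) (h₂ : ∀ m, ‖dyadicSum H m τ s‖ ≤ e₂)
    (h₃ : ∀ m, ‖dyadicSum G m s t - x‖ ≤ e₃) : ‖N - N' - x‖ ≤ e₁ + e₂ + e₃ := by
  refine le_of_tendsto' ((hN.sub hN').sub_const x).norm fun m => ?_
  have e : dyadicSum G m 0 τ + dyadicSum G m τ s + dyadicSum G m s t -
      (dyadicSum G' m 0 τ + dyadicSum G' m τ s + dyadicSum G' m s s) - x =
      dyadicSum H m 0 τ + dyadicSum H m τ s + (dyadicSum G m s t - x) := by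
    rw [dyadicSum_sub hH, dyadicSum_sub hH, dyadicSum_self_eq_zero hG']
    abel
  rw [e]
  exact norm_add₃_le.trans (add_le_add (add_le_add (h₁ m) (h₂ m)) (h₃ m))

end Sewing

/-! ### Compensated Riemann sums of rough integrals -/

section RoughIntegral

variable {V W : Type*} [NormedAddCommGroup V] [NormedSpace ℝ V]
  [NormedAddCommGroup W] [NormedSpace ℝ W] [CompleteSpace W]

theorem tensorLift_coe (B : V →L[ℝ] V →L[ℝ] W) (x : ⨂[ℝ] _ : Fin 2, V) :
    tensorLift B (x : TensorSq V) =
      PiTensorProduct.liftIsometry ℝ (fun _ : Fin 2 => V) W (bilinToMultilinear B) x :=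
  ContinuousLinearMap.extend_eq
    (PiTensorProduct.liftIsometry ℝ (fun _ : Fin 2 => V) W (bilinToMultilinear B))
    (e := (UniformSpace.Completion.toComplL : (⨂[ℝ] _ : Fin 2, V) →L[ℝ] TensorSq V))
    UniformSpace.Completion.denseRange_coe
    (UniformSpace.Completion.isUniformInducing_coe _) x

theorem tensorLift_sub (B B' : V →L[ℝ] V →L[ℝ] W) (x : TensorSq V) :
    tensorLift (B - B') x = tensorLift B x - tensorLift B' x := by
  induction x using UniformSpace.Completion.induction_on with
  | hp => exact isClosed_eq (by fun_prop) (by fun_prop)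
  | ih x =>
    have h : bilinToMultilinear (B - B') = bilinToMultilinear B - bilinToMultilinear B' := by
      ext m; rfl
    rw [tensorLift_coe, tensorLift_coe, tensorLift_coe, h, map_sub]
    rfl

theorem norm_tensorLift_apply_le (B : V →L[ℝ] V →L[ℝ] W) (x : TensorSq V) :
    ‖tensorLift B x‖ ≤ ‖B‖ * ‖x‖ :=
  ((tensorLift B).le_opNorm x).trans (by gcongr; exact norm_tensorLift_le B)

variable {T α : ℝ}

/-- The local approximation `Z_u X_{u,v} + Z'_u 𝕏_{u,v}` of the rough integral `∫_u^v Z d𝐗`. -/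
def roughGerm (X : RoughPath V T α) (Z : ℝ → V →L[ℝ] W) (Z' : ℝ → V →L[ℝ] V →L[ℝ] W)
    (u v : ℝ) : W :=
  Z u (X.path v - X.path u) + tensorLift (Z' u) (X.area u v)

theorem RoughPath.area_self (X : RoughPath V T α) {u : ℝ} (hu : u ∈ Icc 0 T) :
    X.area u u = 0 := by
  have h := X.chen u hu u hu u hu
  have h0 : tensorMk (0 : V) (0 : V) = 0 := by
    have : PiTensorProduct.tprod ℝ ![(0 : V), 0] = 0 :=
      (PiTensorProduct.tprod ℝ).map_coord_zero 0 rfl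
    rw [tensorMk, this, UniformSpace.Completion.coe_zero]
  simpa [h0] using h

theorem roughGerm_self (X : RoughPath V T α) (Z : ℝ → V →L[ℝ] W)
    (Z' : ℝ → V →L[ℝ] V →L[ℝ] W) {u : ℝ} (hu : u ∈ Icc 0 T) : roughGerm X Z Z' u u = 0 := by
  simp [roughGerm, X.area_self hu]

/-- The defect of additivity of the germ, computed by Chen's relation. -/
theorem roughGerm_sub_sub (X : RoughPath V T α) (Z : ℝ → V →L[ℝ] W)
    (Z' : ℝ → V →L[ℝ] V →L[ℝ] W) {u w v : ℝ} (hu : u ∈ Icc 0 T) (hw : w ∈ Icc 0 T)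
    (hv : v ∈ Icc 0 T) :
    roughGerm X Z Z' u v - roughGerm X Z Z' u w - roughGerm X Z Z' w v =
      -((Z w - Z u - Z' u (X.path w - X.path u)) (X.path v - X.path w)) -
        tensorLift (Z' w - Z' u) (X.area w v) := by
  have h : X.area u v = X.area u w + X.area w v +
      tensorMk (X.path w - X.path u) (X.path v - X.path w) := by
    rw [← X.chen u hu w hw v hv]; abel
  have h1 : X.path v - X.path u = (X.path v - X.path w) + (X.path w - X.path u) := by abel
  rw [roughGerm, roughGerm, roughGerm, h, h1, map_add, map_add, map_add, tensorLift_tensorMk,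
    tensorLift_sub]
  simp only [_root_.sub_apply]
  abel

theorem HasRoughIntegral.exists_of_isRiemannSum {X : RoughPath V T α} {Z : ℝ → V →L[ℝ] W}
    {Z' : ℝ → V →L[ℝ] V →L[ℝ] W} {a b : ℝ} {I : W} (h : HasRoughIntegral X Z Z' a b I)
    {ε : ℝ} (hε : 0 < ε) :
    ∃ δ > 0, ∀ v, IsRiemannSum (roughGerm X Z Z') δ a b v → ‖v - I‖ < ε := by
  obtain ⟨δ, hδ, H⟩ := h ε hε
  refine ⟨δ, hδ, fun v hv => ?_⟩
  obtain ⟨n, τ, h0, hn, hτ, rfl⟩ := hv.exists_partition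
  exact H n τ h0 hn hτ

theorem HasRoughIntegral.eq_zero {X : RoughPath V T α} {Z : ℝ → V →L[ℝ] W}
    {Z' : ℝ → V →L[ℝ] V →L[ℝ] W} {a : ℝ} {I : W} (h : HasRoughIntegral X Z Z' a a I) :
    I = 0 := by
  refine norm_le_zero_iff.mp (le_of_forall_pos_lt_add fun ε hε => ?_)
  obtain ⟨δ, -, H⟩ := h.exists_of_isRiemannSum hε
  simpa using H 0 IsRiemannSum.nil

/-- A rough integral over `[0,t]` is the limit of the dyadic sums taken separately over the
intervals `[0,a]`, `[a,b]` and `[b,t]`. -/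
theorem HasRoughIntegral.tendsto_dyadicSum {X : RoughPath V T α} {Z : ℝ → V →L[ℝ] W}
    {Z' : ℝ → V →L[ℝ] V →L[ℝ] W} {a b t : ℝ} {I : W} (h : HasRoughIntegral X Z Z' 0 t I)
    (ha : 0 ≤ a) (hab : a ≤ b) (hbt : b ≤ t) (htT : t ≤ T) :
    Tendsto (fun m => dyadicSum (roughGerm X Z Z') m 0 a + dyadicSum (roughGerm X Z Z') m a b +
      dyadicSum (roughGerm X Z Z') m b t) atTop (𝓝 I) := by
  refine Metric.tendsto_atTop.mpr fun ε hε => ?_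
  obtain ⟨δ, hδ, H⟩ := h.exists_of_isRiemannSum hε
  obtain ⟨n, hn⟩ := pow_unbounded_of_one_lt (t / δ) one_lt_two
  refine ⟨n, fun m hm => ?_⟩
  rw [dist_eq_norm]
  have hm' : t < δ * 2 ^ m := by
    rw [div_lt_iff₀ hδ] at hn
    have : (2 : ℝ) ^ n ≤ 2 ^ m := pow_le_pow_right₀ one_le_two hm
    nlinarith
  have h0 : ∀ c d, 0 ≤ c → c ≤ d → d ≤ t →
      IsRiemannSum (roughGerm X Z Z') δ c d (dyadicSum (roughGerm X Z Z') m c d) :=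
    fun c d hc hcd hdt => isRiemannSum_dyadicSum m hcd
      (fun u hu => roughGerm_self X Z Z' ⟨hc.trans hu.1, (hu.2.trans hdt).trans htT⟩)
      (by linarith)
  exact H _ (((h0 0 a le_rfl ha (hab.trans hbt)).trans (h0 a b ha hab hbt)).trans
    (h0 b t (ha.trans hab) hbt le_rfl))

end RoughIntegral

/-! ### Increments of a semigroup on the domains of powers of its generator -/

namespace C0Semigroup

variable {W : Type*} [NormedAddCommGroup W] [NormedSpace ℝ W]

theorem op_add_apply (S : C0Semigroup W) {s t : ℝ} (hs : 0 ≤ s) (ht : 0 ≤ t) (y : W) :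
    S.op (s + t) y = S.op s (S.op t y) := by
  rw [S.op_add s hs t ht]; rfl

theorem op_comm (S : C0Semigroup W) {s t : ℝ} (hs : 0 ≤ s) (ht : 0 ≤ t) (y : W) :
    S.op s (S.op t y) = S.op t (S.op s y) := by
  rw [← S.op_add_apply hs ht, add_comm, S.op_add_apply ht hs]

theorem HasGenerator.op {S : C0Semigroup W} {y z : W} (h : S.HasGenerator y z) {q : ℝ}
    (hq : 0 ≤ q) : S.HasGenerator (S.op q y) (S.op q z) := by
  refine (((S.op q).continuous.tendsto z).comp h).congr' ?_
  filter_upwards [self_mem_nhdsWithin] with t ht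
  rw [Function.comp_apply, map_smul, map_sub, S.op_comm hq (mem_Ioi.mp ht).le]

theorem HasGenerator.op_sub {S : C0Semigroup W} {y z : W} (h : S.HasGenerator y z) {q : ℝ}
    (hq : 0 ≤ q) : S.HasGenerator (S.op q y - y) (S.op q z - z) := by
  simpa [sub_eq_add_neg] using (h.op hq).add (h.smul (-1))

variable {T B : ℝ}

theorem norm_op_nat_mul_sub_le {S : C0Semigroup W} (hS : ∀ t ∈ Icc 0 T, ‖S.op t‖ ≤ B)
    {h : ℝ} (hh : 0 ≤ h) (y : W) (n : ℕ) (hn : n * h ≤ T) :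
    ‖S.op (n * h) y - y‖ ≤ n * (B * ‖S.op h y - y‖) := by
  induction n with
  | zero => simp [S.op_zero]
  | succ n ih =>
    push_cast at hn ⊢
    have hn' : n * h ≤ T := by linarith
    have hnh : 0 ≤ n * h := by positivity
    rw [add_mul, one_mul, S.op_add_apply hnh hh]
    have e : S.op (n * h) (S.op h y) - y =
        (S.op (n * h) y - y) + S.op (n * h) (S.op h y - y) := by
      rw [map_sub]; abel
    rw [e, add_mul, one_mul]
    exact (norm_add_le _ _).trans (add_le_add (ih hn')
      ((S.op _).le_of_opNorm_le (hS _ ⟨hnh, hn'⟩) _))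

/-- On `D(A)` the semigroup is Lipschitz in time: telescope `S_t y - y` into `n` increments of
length `t / n`, and let `n → ∞`. -/
theorem HasGenerator.norm_op_sub_le {S : C0Semigroup W} (hS : ∀ t ∈ Icc 0 T, ‖S.op t‖ ≤ B)
    {y z : W} (h : S.HasGenerator y z) {t : ℝ} (ht : t ∈ Icc 0 T) :
    ‖S.op t y - y‖ ≤ B * t * ‖z‖ := by
  rcases ht.1.eq_or_lt with rfl | ht0
  · simp [S.op_zero]
  have hlim : Tendsto (fun n : ℕ => t / (n + 1 : ℕ)) atTop (𝓝[>] 0) := by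
    refine tendsto_nhdsWithin_iff.mpr ⟨?_, Eventually.of_forall fun n => ?_⟩
    · exact (tendsto_const_div_atTop_nhds_zero_nat t).comp (tendsto_add_atTop_nat 1)
    · exact mem_Ioi.mpr (by positivity)
  have h1 := ((Tendsto.comp h hlim).norm.const_mul (B * t))
  refine ge_of_tendsto' h1 fun n => ?_
  have hn0 : ((n + 1 : ℕ) : ℝ) ≠ 0 := by positivity
  have e : ((n + 1 : ℕ) : ℝ) * (t / (n + 1 : ℕ)) = t := by field_simp
  have := norm_op_nat_mul_sub_le hS (h := t / (n + 1 : ℕ)) (by positivity) y (n + 1)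
    (by rw [e]; exact ht.2)
  rw [e] at this
  refine this.trans_eq ?_
  rw [Function.comp_apply, norm_smul, norm_inv, Real.norm_of_nonneg (by positivity)]
  field_simp

theorem hasGenerator_of_mem_domPow {S : C0Semigroup W} {n : ℕ} (v : S.domPow n) (i : Fin n) :
    S.HasGenerator (v.1 i.castSucc) (v.1 i.succ) :=
  (S.mem_graph_generator _ _).mp (v.2 i)

theorem norm_coord_le {S : C0Semigroup W} {n : ℕ} (v : S.domPow n) (i : Fin (n + 1)) :
    ‖v.1 i‖ ≤ ‖v‖ :=
  PiLp.norm_apply_le v.1 i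

theorem norm_incl_apply_le {S : C0Semigroup W} {n : ℕ} (v : S.domPow n) :
    ‖S.incl n v‖ ≤ ‖v‖ :=
  norm_coord_le v 0

theorem norm_op_sub_incl_le {S : C0Semigroup W} (hS : ∀ t ∈ Icc 0 T, ‖S.op t‖ ≤ B)
    (hB : 0 ≤ B) {n : ℕ} (v : S.domPow (n + 1)) {t : ℝ} (ht : t ∈ Icc 0 T) :
    ‖S.op t (S.incl (n + 1) v) - S.incl (n + 1) v‖ ≤ B * t * ‖v‖ := by
  refine ((hasGenerator_of_mem_domPow v 0).norm_op_sub_le hS ht).trans ?_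
  have := ht.1
  gcongr
  exact norm_coord_le v _

theorem norm_op_sub_op_incl_le {S : C0Semigroup W} (hS : ∀ t ∈ Icc 0 T, ‖S.op t‖ ≤ B)
    (hB : 0 ≤ B) {n : ℕ} (v : S.domPow (n + 1)) {s t : ℝ} (hs : 0 ≤ s) (hst : s ≤ t)
    (ht : t ≤ T) :
    ‖S.op t (S.incl (n + 1) v) - S.op s (S.incl (n + 1) v)‖ ≤ B ^ 2 * (t - s) * ‖v‖ := by
  have e : S.op t (S.incl (n + 1) v) - S.op s (S.incl (n + 1) v) =
      S.op s (S.op (t - s) (S.incl (n + 1) v) - S.incl (n + 1) v) := by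
    rw [map_sub, ← S.op_add_apply hs (by linarith)]; congr 3; ring
  rw [e]
  refine ((S.op s).le_of_opNorm_le (hS s ⟨hs, hst.trans ht⟩) _).trans ?_
  calc _ ≤ B * (B * (t - s) * ‖v‖) := by
        gcongr; exact norm_op_sub_incl_le hS hB v ⟨by linarith, by linarith⟩
    _ = _ := by ring

/-- On `D(A²)` second-order increments of the semigroup are bounded by the product of the two time
increments. -/
theorem norm_op_sub_op_sub_incl_le {S : C0Semigroup W} (hS : ∀ t ∈ Icc 0 T, ‖S.op t‖ ≤ B)
    (hB : 0 ≤ B) (v : S.domPow 2) {a p q : ℝ} (ha : a ∈ Icc 0 T) (hp : p ∈ Icc 0 T)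
    (hq : q ∈ Icc 0 T) :
    ‖S.op (a + p + q) (S.incl 2 v) - S.op (a + p) (S.incl 2 v) -
      (S.op (a + q) (S.incl 2 v) - S.op a (S.incl 2 v))‖ ≤ B ^ 3 * p * q * ‖v‖ := by
  set y := S.incl 2 v with hy
  have e : S.op (a + p + q) y - S.op (a + p) y - (S.op (a + q) y - S.op a y) =
      S.op a (S.op p (S.op q y - y) - (S.op q y - y)) := by
    rw [add_assoc, S.op_add_apply ha.1 (add_nonneg hp.1 hq.1), S.op_add_apply hp.1 hq.1,
      S.op_add_apply ha.1 hp.1, S.op_add_apply ha.1 hq.1]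
    simp only [map_sub]
  have h1 := ((hasGenerator_of_mem_domPow v 0).op_sub hq.1).norm_op_sub_le hS hp
  have h2 := ((hasGenerator_of_mem_domPow v 1).norm_op_sub_le hS hq)
  have h3 := norm_coord_le v (Fin.succ 1)
  rw [e]
  refine ((S.op a).le_of_opNorm_le (hS a ha) _).trans ?_
  have := hp.1
  have := hq.1
  calc _ ≤ B * (B * p * (B * q * ‖v‖)) := by
        gcongr
        refine h1.trans ?_
        gcongr
        refine h2.trans ?_
        gcongr
    _ = _ := by ring

theorem tendsto_norm_op_sub (S : C0Semigroup W) (y : W) :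
    Tendsto (fun h => ‖S.op h y - y‖) (𝓝[≥] 0) (𝓝 0) := by
  rw [← Ioi_insert, nhdsWithin_insert, tendsto_sup]
  refine ⟨?_, ?_⟩
  · rw [tendsto_pure_left]
    intro s hs
    simpa [S.op_zero] using mem_of_mem_nhds hs
  · simpa using ((S.tendsto_op y).sub_const y).norm

/-- Convolution integrands of a locally bounded strongly continuous semigroup are continuous. -/
theorem continuousOn_op_sub_apply {S : C0Semigroup W} (hS : ∀ t ∈ Icc 0 T, ‖S.op t‖ ≤ B)
    {φ : ℝ → W} {t : ℝ} (ht : t ≤ T) (hφ : ContinuousOn φ (Icc 0 t)) :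
    ContinuousOn (fun u => S.op (t - u) (φ u)) (Icc 0 t) := by
  intro u₀ hu₀
  have habs : Tendsto (fun u : ℝ => |u - u₀|) (𝓝[Icc 0 t] u₀) (𝓝[≥] 0) := by
    refine tendsto_nhdsWithin_iff.mpr ⟨?_, Eventually.of_forall fun u => mem_Ici.mpr (abs_nonneg _)⟩
    have : Continuous fun u : ℝ => |u - u₀| := by fun_prop
    simpa using (this.tendsto u₀).mono_left nhdsWithin_le_nhds
  have h1 := ((S.tendsto_norm_op_sub (φ u₀)).comp habs).const_mul B
  have h2 := (tendsto_iff_norm_sub_tendsto_zero.mp (hφ u₀ hu₀)).const_mul B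
  have h3 := h2.add h1
  rw [mul_zero, add_zero] at h3
  refine tendsto_iff_norm_sub_tendsto_zero.mpr
    (squeeze_zero' (Eventually.of_forall fun _ => norm_nonneg _) ?_ h3)
  filter_upwards [self_mem_nhdsWithin] with u hu
  have hSu : ∀ v ∈ Icc 0 t, ‖S.op (t - v)‖ ≤ B := fun v hv =>
    hS _ ⟨by linarith [hv.2], by linarith [hv.1]⟩
  have e : S.op (t - u) (φ u) - S.op (t - u₀) (φ u₀) =
      S.op (t - u) (φ u - φ u₀) + (S.op (t - u) (φ u₀) - S.op (t - u₀) (φ u₀)) := by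
    rw [map_sub]; abel
  rw [e]
  refine (norm_add_le _ _).trans
    (add_le_add ((S.op _).le_of_opNorm_le (hSu u hu) _) ?_)
  rcases le_total u u₀ with h | h
  · have e : S.op (t - u) (φ u₀) - S.op (t - u₀) (φ u₀) =
        S.op (t - u₀) (S.op |u - u₀| (φ u₀) - φ u₀) := by
      rw [map_sub, abs_of_nonpos (by linarith),
        ← S.op_add_apply (by linarith [hu₀.2]) (by linarith)]
      congr 3; ring
    rw [e]
    exact (S.op _).le_of_opNorm_le (hSu u₀ hu₀) _
  · have e : S.op (t - u) (φ u₀) - S.op (t - u₀) (φ u₀) =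
        -S.op (t - u) (S.op |u - u₀| (φ u₀) - φ u₀) := by
      rw [map_sub, abs_of_nonneg (by linarith),
        ← S.op_add_apply (by linarith [hu.2]) (by linarith), neg_sub]
      congr 3; ring
    rw [e, norm_neg]
    exact (S.op _).le_of_opNorm_le (hSu u hu) _

end C0Semigroup

/-! ### Pointwise bounds contained in the norms -/

section Norms

theorem norm_le_of_enorm_le {E : Type*} [NormedAddCommGroup E] {C : ℝ≥0} {x : E}
    (h : ‖x‖ₑ ≤ C) : ‖x‖ ≤ C := by
  rw [← ofReal_norm, ← ENNReal.ofReal_coe_nnreal] at h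
  exact (ENNReal.ofReal_le_ofReal_iff C.2).mp h

variable {E F : Type*} [NormedAddCommGroup E] [NormedAddCommGroup F] {T γ : ℝ} {C : ℝ≥0}

theorem norm_le_of_holderNorm₂_le {G : ℝ → ℝ → E} (h : holderNorm₂ T γ G ≤ C) {s t : ℝ}
    (hs : s ∈ Icc 0 T) (ht : t ∈ Icc 0 T) (hst : s ≠ t) : ‖G s t‖ ≤ C * |t - s| ^ γ := by
  have h1 : ‖G s t‖ₑ / ENNReal.ofReal (|t - s| ^ γ) ≤ C :=
    le_trans (by
      refine le_iSup₂_of_le s hs (le_iSup₂_of_le t ht ?_)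
      exact le_iSup (fun _ : s ≠ t => ‖G s t‖ₑ / ENNReal.ofReal (|t - s| ^ γ)) hst) h
  have hpos : 0 < |t - s| ^ γ := Real.rpow_pos_of_pos (abs_pos.mpr (sub_ne_zero.mpr hst.symm)) _
  rw [ENNReal.div_le_iff (by simpa using hpos) ENNReal.ofReal_ne_top, ← ofReal_norm,
    ← ENNReal.ofReal_coe_nnreal, ← ENNReal.ofReal_mul C.coe_nonneg] at h1
  exact (ENNReal.ofReal_le_ofReal_iff (by positivity)).mp h1

theorem norm_sub_le_of_holderNorm_le (hγ : 0 < γ) {G : ℝ → E} (h : holderNorm T γ G ≤ C)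
    {s t : ℝ} (hs : s ∈ Icc 0 T) (ht : t ∈ Icc 0 T) : ‖G t - G s‖ ≤ C * |t - s| ^ γ := by
  rcases eq_or_ne s t with rfl | hst
  · simp [Real.zero_rpow hγ.ne']
  · exact norm_le_of_holderNorm₂_le h hs ht hst

theorem continuousOn_of_holderNorm_lt_top (hγ : 0 < γ) {G : ℝ → E}
    (h : holderNorm T γ G < ∞) : ContinuousOn G (Icc 0 T) := by
  lift holderNorm T γ G to ℝ≥0 using h.ne with C hC
  intro s hs
  refine tendsto_iff_norm_sub_tendsto_zero.mpr
    (squeeze_zero' (g := fun t => C * |t - s| ^ γ) (Eventually.of_forall fun _ => norm_nonneg _)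
      ?_ ?_)
  · filter_upwards [self_mem_nhdsWithin] with t ht
    exact norm_sub_le_of_holderNorm_le hγ hC.symm.le hs ht
  · have : Continuous fun t : ℝ => C * |t - s| ^ γ :=
      continuous_const.mul ((by fun_prop : Continuous fun t : ℝ => |t - s|).rpow_const
        fun _ => Or.inr hγ.le)
    simpa [Real.zero_rpow hγ.ne'] using (this.tendsto s).mono_left nhdsWithin_le_nhds

theorem norm_le_of_lipNorm_le {f₀ : ℝ → E → F} (h : lipNorm T f₀ ≤ C) {t : ℝ}
    (ht : t ∈ Icc 0 T) (y : E) : ‖f₀ t y‖ ≤ C * (1 + ‖y‖) := by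
  have h0 : ‖f₀ t 0‖ ≤ C := norm_le_of_enorm_le
    ((le_iSup₂_of_le t ht le_rfl).trans (le_self_add.trans h))
  have h1 : ‖f₀ t y - f₀ t 0‖ ≤ C * ‖y‖ := by
    rcases eq_or_ne y 0 with rfl | hy
    · simp
    have h2 : ‖f₀ t y - f₀ t 0‖ₑ / ‖y - 0‖ₑ ≤ C :=
      (le_iSup₂_of_le (f := fun t (_ : t ∈ Icc 0 T) => ⨆ y, ⨆ z, ⨆ _ : y ≠ z,
          ‖f₀ t y - f₀ t z‖ₑ / ‖y - z‖ₑ) t ht <|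
        le_iSup₂_of_le (f := fun y z => ⨆ _ : y ≠ z, ‖f₀ t y - f₀ t z‖ₑ / ‖y - z‖ₑ) y 0 <|
          le_iSup_of_le hy le_rfl).trans (le_add_self.trans h)
    rw [sub_zero, ENNReal.div_le_iff (by simpa using hy) (by simp), ← ofReal_norm, ← ofReal_norm,
      ← ENNReal.ofReal_coe_nnreal, ← ENNReal.ofReal_mul C.coe_nonneg] at h2
    exact (ENNReal.ofReal_le_ofReal_iff (by positivity)).mp h2
  calc ‖f₀ t y‖ = ‖f₀ t 0 + (f₀ t y - f₀ t 0)‖ := by congr 1; abel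
    _ ≤ C + C * ‖y‖ := (norm_add_le _ _).trans (add_le_add h0 h1)
    _ = _ := by ring

variable [NormedSpace ℝ E] [NormedSpace ℝ F]

/-- The consequences of a bound `B` on the `C_b^{γ,2}` norm of `f` that enter the estimates, with
the derivative taken in the space variable. -/
structure CoeffBounds (T γ B : ℝ) (f : ℝ → E → F) : Prop where
  norm_le : ∀ t ∈ Icc 0 T, ∀ y, ‖f t y‖ ≤ B
  norm_fderiv_le : ∀ t ∈ Icc 0 T, ∀ y, ‖fderiv ℝ (f t) y‖ ≤ B
  lip : ∀ t ∈ Icc 0 T, ∀ y z, ‖f t y - f t z‖ ≤ B * ‖y - z‖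
  lip_fderiv : ∀ t ∈ Icc 0 T, ∀ y z, ‖fderiv ℝ (f t) y - fderiv ℝ (f t) z‖ ≤ B * ‖y - z‖
  taylor : ∀ t ∈ Icc 0 T, ∀ y b, ‖f t (y + b) - f t y - fderiv ℝ (f t) y b‖ ≤ B * ‖b‖ ^ 2
  holder : ∀ s ∈ Icc 0 T, ∀ t ∈ Icc 0 T, ∀ y, ‖f t y - f s y‖ ≤ B * |t - s| ^ γ
  holder_fderiv : ∀ s ∈ Icc 0 T, ∀ t ∈ Icc 0 T, ∀ y,
    ‖fderiv ℝ (f t) y - fderiv ℝ (f s) y‖ ≤ B * |t - s| ^ γ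

theorem IsCb.coeffBounds (hγ : 0 < γ) {f : ℝ → E → F} (hf : IsCb T γ 2 f) {B : ℝ}
    (h : cbNorm T γ 2 f ≤ C) (hCB : C ≤ B) : CoeffBounds T γ B f := by
  have hk : ∀ k ∈ Finset.range 3, ∀ t ∈ Icc 0 T, ∀ y, ‖iteratedFDeriv ℝ k (f t) y‖ ≤ B := by
    intro k hk t ht y
    refine (norm_le_of_enorm_le (C := C) ?_).trans hCB
    refine le_trans ?_ (le_self_add.trans h)
    refine le_iSup₂_of_le (f := fun t (_ : t ∈ Icc 0 T) => ∑ k ∈ Finset.range (2 + 1),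
      ⨆ y, ‖iteratedFDeriv ℝ k (f t) y‖ₑ) t ht ?_
    exact (le_iSup (fun y => ‖iteratedFDeriv ℝ k (f t) y‖ₑ) y).trans
      (Finset.single_le_sum (f := fun k => ⨆ y, ‖iteratedFDeriv ℝ k (f t) y‖ₑ)
        (fun _ _ => zero_le) hk)
  have hh : ∀ k ∈ Finset.range 2, ∀ s ∈ Icc 0 T, ∀ t ∈ Icc 0 T, ∀ y,
      ‖iteratedFDeriv ℝ k (f t) y - iteratedFDeriv ℝ k (f s) y‖ ≤ B * |t - s| ^ γ := by
    intro k hk s hs t ht y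
    refine (norm_sub_le_of_holderNorm_le (C := C) hγ
      (G := fun t => iteratedFDeriv ℝ k (f t) y) ?_ hs ht).trans (by gcongr)
    refine le_trans ?_ (le_add_self.trans h)
    exact (le_iSup (fun y => holderNorm T γ fun t => iteratedFDeriv ℝ k (f t) y) y).trans
      (Finset.single_le_sum (f := fun k => ⨆ y, holderNorm T γ fun t => iteratedFDeriv ℝ k (f t) y)
        (fun _ _ => zero_le) hk)
  have hd1 : ∀ t ∈ Icc 0 T, ∀ y, ‖fderiv ℝ (f t) y‖ ≤ B := fun t ht y => by
    simpa [norm_iteratedFDeriv_one] using hk 1 (by simp) t ht y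
  have hd2 : ∀ t ∈ Icc 0 T, ∀ y, ‖fderiv ℝ (fderiv ℝ (f t)) y‖ ≤ B := fun t ht y => by
    have := hk 2 (by simp) t ht y
    rwa [← norm_iteratedFDeriv_fderiv, norm_iteratedFDeriv_one] at this
  have hdiff : ∀ t ∈ Icc 0 T, Differentiable ℝ (f t) := fun t ht =>
    (hf.1 t ht).differentiable (by simp)
  have hdiff' : ∀ t ∈ Icc 0 T, Differentiable ℝ (fderiv ℝ (f t)) := fun t ht =>
    ((hf.1 t ht).fderiv_right (m := 1) (by norm_num)).differentiable (by simp)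
  have hlip' : ∀ t ∈ Icc 0 T, ∀ y z, ‖fderiv ℝ (f t) y - fderiv ℝ (f t) z‖ ≤ B * ‖y - z‖ :=
    fun t ht y z => convex_univ.norm_image_sub_le_of_norm_fderiv_le
      (fun x _ => hdiff' t ht x) (fun x _ => hd2 t ht x) (mem_univ z) (mem_univ y)
  refine ⟨fun t ht y => ?_, hd1, fun t ht y z => ?_, hlip', fun t ht y b => ?_,
    fun s hs t ht y => ?_, fun s hs t ht y => ?_⟩
  · simpa using hk 0 (by simp) t ht y
  · exact convex_univ.norm_image_sub_le_of_norm_fderiv_le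
      (fun x _ => hdiff t ht x) (fun x _ => hd1 t ht x) (mem_univ z) (mem_univ y)
  · have hB : 0 ≤ B := (norm_nonneg _).trans (hd1 t ht y)
    have := (convex_closedBall y ‖b‖).norm_image_sub_le_of_norm_fderiv_le' (𝕜 := ℝ)
      (f := f t) (φ := fderiv ℝ (f t) y) (C := B * ‖b‖)
      (fun x _ => hdiff t ht x) (fun x hx => (hlip' t ht x y).trans (by
        gcongr; simpa [dist_eq_norm] using hx))
      (x := y) (y := y + b) (by simp) (by simp)
    simpa [sq, mul_assoc] using this
  · have := hh 0 (by simp) s hs t ht y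
    rwa [iteratedFDeriv_zero_eq_comp, iteratedFDeriv_zero_eq_comp, Function.comp_apply,
      Function.comp_apply, ← map_sub, LinearIsometryEquiv.norm_map] at this
  · have := hh 1 (by simp) s hs t ht y
    refine le_trans ?_ this
    refine ContinuousLinearMap.opNorm_le_bound _ (norm_nonneg _) fun x => ?_
    simpa using (iteratedFDeriv ℝ 1 (f t) y - iteratedFDeriv ℝ 1 (f s) y).le_opNorm fun _ => x

end Norms

/-! ### Rough Riemann sums of the composition of a coefficient with a controlled path -/

section Composition

variable {V W F : Type*} [NormedAddCommGroup V] [NormedSpace ℝ V]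
  [NormedAddCommGroup W] [NormedSpace ℝ W] [NormedAddCommGroup F] [NormedSpace ℝ F]
  {T α : ℝ}

theorem norm_comp_sub_comp_le {E : Type*} [NormedAddCommGroup E] [NormedSpace ℝ E]
    (P P' : F →L[ℝ] W) (Q Q' : E →L[ℝ] F) :
    ‖P.comp Q - P'.comp Q'‖ ≤ ‖P - P'‖ * ‖Q‖ + ‖P'‖ * ‖Q - Q'‖ := by
  have e : P.comp Q - P'.comp Q' = (P - P').comp Q + P'.comp (Q - Q') := by
    rw [ContinuousLinearMap.sub_comp, ContinuousLinearMap.comp_sub]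
    abel
  rw [e]
  have h1 := ContinuousLinearMap.opNorm_comp_le (P - P') Q
  have h2 := ContinuousLinearMap.opNorm_comp_le P' (Q - Q')
  have h3 := norm_add_le ((P - P').comp Q) (P'.comp (Q - Q'))
  linarith

theorem norm_compL_comp_le (P : F →L[ℝ] W) (Q : V →L[ℝ] V →L[ℝ] F) :
    ‖(ContinuousLinearMap.compL ℝ V F W P).comp Q‖ ≤ ‖P‖ * ‖Q‖ := by
  refine ContinuousLinearMap.opNorm_le_bound _ (by positivity) fun x => ?_
  calc ‖P.comp (Q x)‖ ≤ ‖P‖ * ‖Q x‖ := ContinuousLinearMap.opNorm_comp_le _ _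
    _ ≤ ‖P‖ * (‖Q‖ * ‖x‖) := by gcongr; exact Q.le_opNorm x
    _ = _ := by ring

theorem norm_compL_comp_sub_le (P P' : F →L[ℝ] W) (Q Q' : V →L[ℝ] V →L[ℝ] F) :
    ‖(ContinuousLinearMap.compL ℝ V F W P).comp Q -
      (ContinuousLinearMap.compL ℝ V F W P').comp Q'‖ ≤ ‖P - P'‖ * ‖Q‖ + ‖P'‖ * ‖Q - Q'‖ := by
  refine ContinuousLinearMap.opNorm_le_bound _ (by positivity) fun x => ?_
  have h1 := norm_comp_sub_comp_le P P' (Q x) (Q' x)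
  have h2 := Q.le_opNorm x
  have h3 := (Q - Q').le_opNorm x
  calc ‖P.comp (Q x) - P'.comp (Q' x)‖ ≤ ‖P - P'‖ * ‖Q x‖ + ‖P'‖ * ‖Q x - Q' x‖ := h1
    _ ≤ ‖P - P'‖ * (‖Q‖ * ‖x‖) + ‖P'‖ * (‖Q - Q'‖ * ‖x‖) := by gcongr; exact h3
    _ = _ := by ring

section operatorGerm

variable [CompleteSpace W] {X : RoughPath V T α} {f : ℝ → W → V →L[ℝ] F} {Y : ℝ → W}
  {Y' : ℝ → V →L[ℝ] W}

/-- The germ of the rough integral of `s ↦ P_s f(s, Y_s)` for a family `P` of operators. -/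
def operatorGerm (X : RoughPath V T α) (f : ℝ → W → V →L[ℝ] F) (Y : ℝ → W)
    (Y' : ℝ → V →L[ℝ] W) (P : ℝ → F →L[ℝ] W) : ℝ → ℝ → W :=
  roughGerm X (fun s => (P s).comp (f s (Y s)))
    (fun s => (ContinuousLinearMap.compL ℝ V F W (P s)).comp
      ((fderiv ℝ (f s) (Y s)).comp (Y' s)))

theorem operatorGerm_sub (P P' P'' : ℝ → F →L[ℝ] W) (hP : ∀ s, P'' s = P s - P' s) (u v : ℝ) :
    operatorGerm X f Y Y' P'' u v =
      operatorGerm X f Y Y' P u v - operatorGerm X f Y Y' P' u v := by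
  have e : (ContinuousLinearMap.compL ℝ V F W (P u - P' u)).comp
      ((fderiv ℝ (f u) (Y u)).comp (Y' u)) =
      (ContinuousLinearMap.compL ℝ V F W (P u)).comp ((fderiv ℝ (f u) (Y u)).comp (Y' u)) -
      (ContinuousLinearMap.compL ℝ V F W (P' u)).comp ((fderiv ℝ (f u) (Y u)).comp (Y' u)) := by
    ext x y; simp
  simp only [operatorGerm, roughGerm, hP, e, tensorLift_sub]
  simp only [ContinuousLinearMap.comp_apply, _root_.sub_apply]
  abel

theorem operatorGerm_self (P : ℝ → F →L[ℝ] W) {u : ℝ} (hu : u ∈ Icc 0 T) :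
    operatorGerm X f Y Y' P u u = 0 :=
  roughGerm_self X _ _ hu

end operatorGerm

/-- The remainder `R_{s,t} = Y_t - Y_s - Y'_s (X_t - X_s)` satisfies `|R_{s,t}| ≤ ρ |t - s|^{2α}` on
`[a,b]`. The power is written as a square since `|t - s|^α` is the only fractional power in the
estimates. -/
def RemainderBound (α : ℝ) (X : ℝ → V) (Y : ℝ → W) (Y' : ℝ → V →L[ℝ] W) (a b ρ : ℝ) : Prop :=
  ∀ s t, a ≤ s → s ≤ t → t ≤ b → ‖Y t - Y s - Y' s (X t - X s)‖ ≤ ρ * ((t - s) ^ α) ^ 2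

/-- If every bound `ρ` on the remainder improves to `A + ρ / 2`, then `2 A` is a bound. -/
theorem RemainderBound.of_improvement {X : ℝ → V} {Y : ℝ → W} {Y' : ℝ → V →L[ℝ] W}
    {a b A ρ : ℝ} (h0 : RemainderBound α X Y Y' a b ρ) (hρ : 0 ≤ ρ) (hA : 0 ≤ A)
    (h : ∀ ρ, 0 ≤ ρ → RemainderBound α X Y Y' a b ρ → RemainderBound α X Y Y' a b (A + ρ / 2)) :
    RemainderBound α X Y Y' a b (2 * A) := by
  have hn : ∀ n : ℕ, RemainderBound α X Y Y' a b (2 * A + ρ * (1 / 2) ^ n) := by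
    intro n
    induction n with
    | zero =>
      intro s t hs hst ht
      refine (h0 s t hs hst ht).trans ?_
      gcongr
      linarith
    | succ n ih =>
      have := h _ (by positivity) ih
      convert this using 1
      ring
  intro s t hs hst ht
  have hlim : Tendsto (fun n : ℕ => (2 * A + ρ * (1 / 2 : ℝ) ^ n) * ((t - s) ^ α) ^ 2) atTop
      (𝓝 ((2 * A + ρ * 0) * ((t - s) ^ α) ^ 2)) :=
    (((tendsto_pow_atTop_nhds_zero_of_lt_one (by norm_num) (by norm_num)).const_mul
      ρ).const_add _).mul_const _
  simpa using ge_of_tendsto' hlim fun n => hn n s t hs hst ht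

/-- A path `Y` with Gubinelli derivative `Y'_t = J f(t, Y_t)`, where `J` is a contraction
(the inclusion `D(A²) → W` in the application) and a single constant `B` bounds the rough path, the
coefficient and the time horizon. -/
structure IsCoeffControlled (X : RoughPath V T α) (B : ℝ) (J : F →L[ℝ] W) (f : ℝ → W → V →L[ℝ] F)
    (Y : ℝ → W) (Y' : ℝ → V →L[ℝ] W) : Prop where
  lt_alpha : 1 / 3 < α
  alpha_lt : α < 1 / 2
  one_le : 1 ≤ B
  time_le : T ≤ B
  path : ∀ s t, 0 ≤ s → s ≤ t → t ≤ T → ‖X.path t - X.path s‖ ≤ B * (t - s) ^ α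
  area : ∀ s t, 0 ≤ s → s ≤ t → t ≤ T → ‖X.area s t‖ ≤ B * ((t - s) ^ α) ^ 2
  coeff : CoeffBounds T (2 * α) B f
  norm_map_le : ∀ x, ‖J x‖ ≤ ‖x‖
  deriv_eq : ∀ t ∈ Icc 0 T, Y' t = J.comp (f t (Y t))

theorem rpow_two_mul_of_nonneg {x : ℝ} (hx : 0 ≤ x) (α : ℝ) : x ^ (2 * α) = (x ^ α) ^ 2 := by
  rw [mul_comm, Real.rpow_mul hx, Real.rpow_two]

theorem rpow_three_mul_of_nonneg {x : ℝ} (hx : 0 ≤ x) (α : ℝ) : x ^ (3 * α) = (x ^ α) ^ 3 := by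
  rw [mul_comm, Real.rpow_mul hx]
  exact_mod_cast Real.rpow_natCast (x ^ α) 3

namespace IsCoeffControlled

variable {X : RoughPath V T α} {B : ℝ} {J : F →L[ℝ] W} {f : ℝ → W → V →L[ℝ] F} {Y : ℝ → W}
  {Y' : ℝ → V →L[ℝ] W} {u v ρ : ℝ}

section
variable (h : IsCoeffControlled X B J f Y Y')
include h

theorem nonneg : 0 ≤ B := zero_le_one.trans h.one_le

theorem rpow_le (hu : 0 ≤ u) (huv : u ≤ v) (hv : v ≤ T) : (v - u) ^ α ≤ B := by
  have h1 := h.lt_alpha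
  have h2 := h.alpha_lt
  have h3 := h.one_le
  have h4 := h.time_le
  calc (v - u) ^ α ≤ B ^ α := Real.rpow_le_rpow (by linarith) (by linarith) (by linarith)
    _ ≤ B ^ (1 : ℝ) := Real.rpow_le_rpow_of_exponent_le h3 (by linarith)
    _ = B := Real.rpow_one B

theorem sub_le (hu : 0 ≤ u) (huv : u ≤ v) (hv : v ≤ T) : v - u ≤ B * ((v - u) ^ α) ^ 2 := by
  have h1 := h.lt_alpha
  have h2 := h.alpha_lt
  have h3 := h.one_le
  have h4 := h.time_le
  have h0 : 0 ≤ v - u := by linarith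
  have e : v - u = (v - u) ^ (1 - 2 * α) * (v - u) ^ (2 * α) := by
    rw [← Real.rpow_add_of_nonneg h0 (by linarith) (by linarith)]
    simp
  rw [← rpow_two_mul_of_nonneg h0]
  nth_rw 1 [e]
  gcongr
  calc (v - u) ^ (1 - 2 * α) ≤ B ^ (1 - 2 * α) :=
        Real.rpow_le_rpow (by linarith) (by linarith) (by linarith)
    _ ≤ B ^ (1 : ℝ) := Real.rpow_le_rpow_of_exponent_le h3 (by linarith)
    _ = B := Real.rpow_one B

theorem norm_deriv_le {t : ℝ} (ht : t ∈ Icc 0 T) : ‖Y' t‖ ≤ B := by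
  rw [h.deriv_eq t ht]
  refine ContinuousLinearMap.opNorm_le_bound _ h.nonneg fun x => ?_
  exact (h.norm_map_le _).trans ((f t (Y t)).le_of_opNorm_le (h.coeff.norm_le t ht _) _)

theorem norm_deriv_apply_le (hu : 0 ≤ u) (huv : u ≤ v) (hv : v ≤ T) :
    ‖Y' u (X.path v - X.path u)‖ ≤ B ^ 2 * (v - u) ^ α :=
  calc ‖Y' u (X.path v - X.path u)‖ ≤ B * (B * (v - u) ^ α) :=
        ContinuousLinearMap.le_of_opNorm_le_of_le _ (h.norm_deriv_le ⟨hu, huv.trans hv⟩)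
          (h.path u v hu huv hv)
    _ = _ := by ring

theorem norm_increment_le (hu : 0 ≤ u) (huv : u ≤ v) (hv : v ≤ T)
    (hR : ‖Y v - Y u - Y' u (X.path v - X.path u)‖ ≤ ρ * ((v - u) ^ α) ^ 2) :
    ‖Y v - Y u‖ ≤ B ^ 2 * (v - u) ^ α + ρ * ((v - u) ^ α) ^ 2 := by
  have e : Y v - Y u = Y' u (X.path v - X.path u) +
    (Y v - Y u - Y' u (X.path v - X.path u)) := by abel
  rw [e]
  exact (norm_add_le _ _).trans (add_le_add (h.norm_deriv_apply_le hu huv hv) hR)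

theorem norm_coeff_sub_le (hu : 0 ≤ u) (huv : u ≤ v) (hv : v ≤ T) :
    ‖f v (Y v) - f u (Y u)‖ ≤ B * ((v - u) ^ α) ^ 2 + B * ‖Y v - Y u‖ := by
  have hu' : u ∈ Icc 0 T := ⟨hu, huv.trans hv⟩
  have hv' : v ∈ Icc 0 T := ⟨hu.trans huv, hv⟩
  have h1 := h.coeff.holder u hu' v hv' (Y v)
  rw [abs_of_nonneg (by linarith), rpow_two_mul_of_nonneg (by linarith)] at h1
  rw [← sub_add_sub_cancel]
  exact (norm_add_le _ _).trans (add_le_add h1 (h.coeff.lip u hu' _ _))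

theorem norm_fderiv_coeff_sub_le (hu : 0 ≤ u) (huv : u ≤ v) (hv : v ≤ T) :
    ‖fderiv ℝ (f v) (Y v) - fderiv ℝ (f u) (Y u)‖ ≤
      B * ((v - u) ^ α) ^ 2 + B * ‖Y v - Y u‖ := by
  have hu' : u ∈ Icc 0 T := ⟨hu, huv.trans hv⟩
  have hv' : v ∈ Icc 0 T := ⟨hu.trans huv, hv⟩
  have h1 := h.coeff.holder_fderiv u hu' v hv' (Y v)
  rw [abs_of_nonneg (by linarith), rpow_two_mul_of_nonneg (by linarith)] at h1
  rw [← sub_add_sub_cancel]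
  exact (norm_add_le _ _).trans (add_le_add h1 (h.coeff.lip_fderiv u hu' _ _))

theorem norm_deriv_sub_le (hu : 0 ≤ u) (huv : u ≤ v) (hv : v ≤ T) :
    ‖Y' v - Y' u‖ ≤ B * ((v - u) ^ α) ^ 2 + B * ‖Y v - Y u‖ := by
  refine le_trans ?_ (h.norm_coeff_sub_le hu huv hv)
  rw [h.deriv_eq u ⟨hu, huv.trans hv⟩, h.deriv_eq v ⟨hu.trans huv, hv⟩]
  refine ContinuousLinearMap.opNorm_le_bound _ (norm_nonneg _) fun x => ?_
  have e : (J.comp (f v (Y v)) - J.comp (f u (Y u))) x = J ((f v (Y v) - f u (Y u)) x) := by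
    simp
  rw [e]
  exact (h.norm_map_le _).trans (ContinuousLinearMap.le_opNorm _ _)

/-- The remainder of `f(Y)` is bounded linearly in the remainder of `Y`: the quadratic Taylor
error is taken only along the bounded part `Y'_u X_{u,v}` of the increment of `Y`, and the Lipschitz
bound is used for the rest. -/
theorem norm_coeff_remainder_le (hρ : 0 ≤ ρ) (hu : 0 ≤ u) (huv : u ≤ v) (hv : v ≤ T)
    (hR : ‖Y v - Y u - Y' u (X.path v - X.path u)‖ ≤ ρ * ((v - u) ^ α) ^ 2) :
    ‖f v (Y v) - f u (Y u) - fderiv ℝ (f u) (Y u) (Y' u (X.path v - X.path u))‖ ≤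
      2 * B ^ 5 * (1 + ρ) * ((v - u) ^ α) ^ 2 := by
  have hu' : u ∈ Icc 0 T := ⟨hu, huv.trans hv⟩
  have hv' : v ∈ Icc 0 T := ⟨hu.trans huv, hv⟩
  have hB := h.nonneg
  have hq : 0 ≤ (v - u) ^ α := Real.rpow_nonneg (by linarith) _
  set b := Y' u (X.path v - X.path u) with hb
  have h1 := h.coeff.holder u hu' v hv' (Y v)
  rw [abs_of_nonneg (by linarith), rpow_two_mul_of_nonneg (by linarith)] at h1
  have h2 := h.coeff.lip u hu' (Y v) (Y u + b)
  have h3 := h.coeff.taylor u hu' (Y u) b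
  have h4 := h.norm_deriv_apply_le hu huv hv
  rw [← hb] at h4
  rw [← sub_sub] at h2
  set q := (v - u) ^ α
  have hBB : B ≤ B ^ 5 := le_self_pow₀ h.one_le (by norm_num)
  have e : f v (Y v) - f u (Y u) - fderiv ℝ (f u) (Y u) b =
      (f v (Y v) - f u (Y v)) + (f u (Y v) - f u (Y u + b)) +
      (f u (Y u + b) - f u (Y u) - fderiv ℝ (f u) (Y u) b) := by abel
  rw [e]
  refine (norm_add₃_le).trans ?_
  calc _ ≤ B * q ^ 2 + B * (ρ * q ^ 2) + B * (B ^ 2 * q) ^ 2 := by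
        refine add_le_add (add_le_add h1 (h2.trans ?_)) (h3.trans ?_) <;> gcongr
    _ = (B + B * ρ + B ^ 5) * q ^ 2 := by ring
    _ ≤ (B ^ 5 + B ^ 5 * ρ + B ^ 5 * (1 + ρ)) * q ^ 2 := by
        gcongr
        nlinarith [pow_nonneg hB 5]
    _ = _ := by ring

theorem norm_comp_deriv_sub_le (hρ : 0 ≤ ρ) (hu : 0 ≤ u) (huv : u ≤ v) (hv : v ≤ T)
    (hR : ‖Y v - Y u - Y' u (X.path v - X.path u)‖ ≤ ρ * ((v - u) ^ α) ^ 2) :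
    ‖(fderiv ℝ (f v) (Y v)).comp (Y' v) - (fderiv ℝ (f u) (Y u)).comp (Y' u)‖ ≤
      4 * B ^ 4 * (1 + ρ) * (v - u) ^ α := by
  have hu' : u ∈ Icc 0 T := ⟨hu, huv.trans hv⟩
  have hv' : v ∈ Icc 0 T := ⟨hu.trans huv, hv⟩
  have hB := h.nonneg
  have hB1 := h.one_le
  have hq : 0 ≤ (v - u) ^ α := Real.rpow_nonneg (by linarith) _
  have hqB := h.rpow_le hu huv hv
  have h1 := h.norm_increment_le hu huv hv hR
  have h2 := h.norm_fderiv_coeff_sub_le hu huv hv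
  have h3 := h.norm_deriv_sub_le hu huv hv
  set q := (v - u) ^ α
  have h4 : B * q ^ 2 + B * ‖Y v - Y u‖ ≤ 2 * B ^ 3 * (1 + ρ) * q :=
    calc B * q ^ 2 + B * ‖Y v - Y u‖ ≤ B * q ^ 2 + B * (B ^ 2 * q + ρ * q ^ 2) := by gcongr
      _ = (B * q + B ^ 3 + B * ρ * q) * q := by ring
      _ ≤ (B * B + B ^ 3 + B * ρ * B) * q := by gcongr
      _ ≤ (B ^ 3 + B ^ 3 + B ^ 3 * ρ + B ^ 3 * ρ) * q := by
        have h5 : B * B ≤ B ^ 3 := by nlinarith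
        have h6 : B * B * ρ ≤ B ^ 3 * ρ := by gcongr
        have h7 : 0 ≤ B ^ 3 * ρ := by positivity
        refine mul_le_mul_of_nonneg_right ?_ hq
        nlinarith [pow_nonneg hB 3]
      _ = _ := by ring
  refine (norm_comp_sub_comp_le _ _ _ _).trans ?_
  calc ‖fderiv ℝ (f v) (Y v) - fderiv ℝ (f u) (Y u)‖ * ‖Y' v‖ +
        ‖fderiv ℝ (f u) (Y u)‖ * ‖Y' v - Y' u‖
    _ ≤ (2 * B ^ 3 * (1 + ρ) * q) * B + B * (2 * B ^ 3 * (1 + ρ) * q) := by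
        gcongr
        · exact h2.trans h4
        · exact h.norm_deriv_le hv'
        · exact h.coeff.norm_fderiv_le u hu' _
        · exact h3.trans h4
    _ = _ := by ring

theorem norm_comp_deriv_le (hu : u ∈ Icc 0 T) :
    ‖(fderiv ℝ (f u) (Y u)).comp (Y' u)‖ ≤ B ^ 2 := by
  have hB := h.nonneg
  refine (ContinuousLinearMap.opNorm_comp_le _ _).trans ?_
  rw [sq]
  gcongr
  · exact h.coeff.norm_fderiv_le u hu _
  · exact h.norm_deriv_le hu

/-- `s ↦ P_s f(s, Y_s)` is controlled by `X`, with a remainder linear in `p` and `ρ`. -/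
theorem norm_operator_remainder_le {P : ℝ → F →L[ℝ] W} {p : ℝ} (hρ : 0 ≤ ρ) (hu : 0 ≤ u)
    (huv : u ≤ v) (hv : v ≤ T) (hp : 0 ≤ p) (hP : ‖P u‖ ≤ p) (hP' : ‖P v - P u‖ ≤ p * (v - u))
    (hR : ‖Y v - Y u - Y' u (X.path v - X.path u)‖ ≤ ρ * ((v - u) ^ α) ^ 2) :
    ‖(P v).comp (f v (Y v)) - (P u).comp (f u (Y u)) -
      (P u).comp (fderiv ℝ (f u) (Y u) (Y' u (X.path v - X.path u)))‖ ≤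
      4 * B ^ 5 * p * (1 + ρ) * ((v - u) ^ α) ^ 2 := by
  have hB := h.nonneg
  have hB1 := h.one_le
  have h1 := h.norm_coeff_remainder_le hρ hu huv hv hR
  have h2 := h.sub_le hu huv hv
  have h3 := h.coeff.norm_le v ⟨hu.trans huv, hv⟩ (Y v)
  have hq : 0 ≤ (v - u) ^ α := Real.rpow_nonneg (by linarith) _
  set q := (v - u) ^ α
  set z := fderiv ℝ (f u) (Y u) (Y' u (X.path v - X.path u))
  have e : (P v).comp (f v (Y v)) - (P u).comp (f u (Y u)) - (P u).comp z =
      (P v).comp (f v (Y v)) - (P u).comp (f u (Y u) + z) := by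
    rw [ContinuousLinearMap.comp_add]
    abel
  rw [e]
  refine (norm_comp_sub_comp_le _ _ _ _).trans ?_
  rw [← sub_sub]
  calc ‖P v - P u‖ * ‖f v (Y v)‖ + ‖P u‖ * ‖f v (Y v) - f u (Y u) - z‖
    _ ≤ (p * (B * q ^ 2)) * B + p * (2 * B ^ 5 * (1 + ρ) * q ^ 2) := by
        gcongr
        exact hP'.trans (by gcongr)
    _ = (B ^ 2 * 1 + 2 * B ^ 5 * (1 + ρ)) * (p * q ^ 2) := by ring
    _ ≤ (2 * B ^ 5 * (1 + ρ) + 2 * B ^ 5 * (1 + ρ)) * (p * q ^ 2) := by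
        have h4 : B ^ 2 ≤ 2 * B ^ 5 := by
          have : B ^ 2 ≤ B ^ 5 := pow_le_pow_right₀ hB1 (by norm_num)
          linarith [pow_nonneg hB 5]
        gcongr
        linarith
    _ = _ := by ring

theorem norm_operator_deriv_sub_le {P : ℝ → F →L[ℝ] W} {p : ℝ} (hρ : 0 ≤ ρ) (hu : 0 ≤ u)
    (huv : u ≤ v) (hv : v ≤ T) (hp : 0 ≤ p) (hP : ‖P u‖ ≤ p) (hP' : ‖P v - P u‖ ≤ p * (v - u))
    (hR : ‖Y v - Y u - Y' u (X.path v - X.path u)‖ ≤ ρ * ((v - u) ^ α) ^ 2) :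
    ‖(ContinuousLinearMap.compL ℝ V F W (P v)).comp ((fderiv ℝ (f v) (Y v)).comp (Y' v)) -
      (ContinuousLinearMap.compL ℝ V F W (P u)).comp ((fderiv ℝ (f u) (Y u)).comp (Y' u))‖ ≤
      5 * B ^ 4 * p * (1 + ρ) * (v - u) ^ α := by
  have hB := h.nonneg
  have h1 := h.norm_comp_deriv_sub_le hρ hu huv hv hR
  have h2 := h.sub_le hu huv hv
  have h3 := h.norm_comp_deriv_le ⟨hu.trans huv, hv⟩
  have hqB := h.rpow_le hu huv hv
  have hq : 0 ≤ (v - u) ^ α := Real.rpow_nonneg (by linarith) _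
  set q := (v - u) ^ α
  set D := (fderiv ℝ (f v) (Y v)).comp (Y' v)
  set D' := (fderiv ℝ (f u) (Y u)).comp (Y' u)
  refine (norm_compL_comp_sub_le _ _ _ _).trans ?_
  calc ‖P v - P u‖ * ‖D‖ + ‖P u‖ * ‖D - D'‖
    _ ≤ (p * (B * (B * q))) * B ^ 2 + p * (4 * B ^ 4 * (1 + ρ) * q) := by
        gcongr
        refine hP'.trans ?_
        gcongr
        refine h2.trans ?_
        rw [sq]
        gcongr
    _ = (B ^ 4 * 1 + 4 * B ^ 4 * (1 + ρ)) * (p * q) := by ring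
    _ ≤ (B ^ 4 * (1 + ρ) + 4 * B ^ 4 * (1 + ρ)) * (p * q) := by
        gcongr
        linarith
    _ = _ := by ring

end

variable [CompleteSpace W]

variable (h : IsCoeffControlled X B J f Y Y')
include h

theorem norm_operatorGerm_le {P : ℝ → F →L[ℝ] W} {p : ℝ} (hu : 0 ≤ u) (huv : u ≤ v)
    (hv : v ≤ T) (hP : ‖P u‖ ≤ p) : ‖operatorGerm X f Y Y' P u v‖ ≤ 2 * B ^ 5 * p := by
  have hu' : u ∈ Icc 0 T := ⟨hu, huv.trans hv⟩
  have hB := h.nonneg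
  have hB1 := h.one_le
  have hp : 0 ≤ p := (norm_nonneg _).trans hP
  have hqB := h.rpow_le hu huv hv
  have hq : 0 ≤ (v - u) ^ α := Real.rpow_nonneg (by linarith) _
  have h1 := h.path u v hu huv hv
  have h2 := h.area u v hu huv hv
  have h3 := h.coeff.norm_le u hu' (Y u)
  have h4 := h.norm_comp_deriv_le hu'
  set q := (v - u) ^ α
  calc _ ≤ ‖P u‖ * (‖f u (Y u)‖ * ‖X.path v - X.path u‖) +
        ‖P u‖ * ‖(fderiv ℝ (f u) (Y u)).comp (Y' u)‖ * ‖X.area u v‖ := by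
        refine (norm_add_le _ _).trans (add_le_add ?_ ?_)
        · refine ((P u).le_opNorm _).trans ?_
          gcongr
          exact (f u (Y u)).le_opNorm _
        · refine (norm_tensorLift_apply_le _ _).trans ?_
          gcongr
          exact norm_compL_comp_le _ _
    _ ≤ p * (B * (B * B)) + p * B ^ 2 * (B * B ^ 2) := by
        gcongr
        · exact h1.trans (by gcongr)
        · exact h2.trans (by gcongr)
    _ = (B ^ 3 + B ^ 5) * p := by ring
    _ ≤ (B ^ 5 + B ^ 5) * p := by
        gcongr
        norm_num
    _ = _ := by ring

/-- The sewing estimate for `∫ P_s f(s, Y_s) d𝐗_s`; it is linear in the size `ρ` of the remainder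
of `Y` and in the size `p` of `P`. -/
theorem norm_dyadicSum_operatorGerm_sub_le {P : ℝ → F →L[ℝ] W} {p a b : ℝ} (hρ : 0 ≤ ρ)
    (ha : 0 ≤ a) (hab : a ≤ b) (hb : b ≤ T) (hp : 0 ≤ p)
    (hP : ∀ u, a ≤ u → u ≤ b → ‖P u‖ ≤ p)
    (hP' : ∀ u v, a ≤ u → u ≤ v → v ≤ b → ‖P v - P u‖ ≤ p * (v - u))
    (hR : RemainderBound α X.path Y Y' a b ρ) (m : ℕ) :
    ‖dyadicSum (operatorGerm X f Y Y' P) m a b - operatorGerm X f Y Y' P a b‖ ≤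
      9 * B ^ 6 * (1 - 2 ^ (1 - 3 * α))⁻¹ * p * (1 + ρ) * ((b - a) ^ α) ^ 3 := by
  have hB := h.nonneg
  have hB1 := h.one_le
  have hα : 0 < α := by linarith [h.lt_alpha]
  have key : ∀ u w v, a ≤ u → u ≤ w → w ≤ v → v ≤ b →
      ‖operatorGerm X f Y Y' P u v - operatorGerm X f Y Y' P u w -
        operatorGerm X f Y Y' P w v‖ ≤ (9 * B ^ 6 * p * (1 + ρ)) * (v - u) ^ (3 * α) := by
    intro u w v hau huw hwv hvb
    have hu0 : 0 ≤ u := ha.trans hau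
    have hw0 : 0 ≤ w := hu0.trans huw
    have hwT : w ≤ T := (hwv.trans hvb).trans hb
    have hu : u ∈ Icc 0 T := ⟨hu0, huw.trans hwT⟩
    have hw : w ∈ Icc 0 T := ⟨hw0, hwT⟩
    have hv : v ∈ Icc 0 T := ⟨hw0.trans hwv, hvb.trans hb⟩
    have hRuw := hR u w hau huw (hwv.trans hvb)
    have h5 := hP' u w hau huw (hwv.trans hvb)
    have h6 := hP u hau (huw.trans (hwv.trans hvb))
    have hZ := h.norm_operator_remainder_le hρ hu0 huw hwT hp h6 h5 hRuw
    have hZ' := h.norm_operator_deriv_sub_le hρ hu0 huw hwT hp h6 h5 hRuw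
    have h3 := h.path w v hw0 hwv hv.2
    have h4 := h.area w v hw0 hwv hv.2
    have hq1 : (w - u) ^ α ≤ (v - u) ^ α := by
      apply Real.rpow_le_rpow <;> linarith
    have hq2 : (v - w) ^ α ≤ (v - u) ^ α := by
      apply Real.rpow_le_rpow <;> linarith
    have hq10 : 0 ≤ (w - u) ^ α := Real.rpow_nonneg (by linarith) _
    have hq20 : 0 ≤ (v - w) ^ α := Real.rpow_nonneg (by linarith) _
    have hq0 := hq10.trans hq1
    rw [rpow_three_mul_of_nonneg (by linarith)]
    set q := (v - u) ^ α
    set q1 := (w - u) ^ α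
    set q2 := (v - w) ^ α
    rw [operatorGerm, roughGerm_sub_sub X _ _ hu hw hv]
    refine (norm_sub_le _ _).trans ?_
    rw [norm_neg]
    have hZ1 := ContinuousLinearMap.le_of_opNorm_le_of_le _ hZ h3
    have hZ1' := (norm_tensorLift_apply_le _ (X.area w v)).trans
      (mul_le_mul hZ' h4 (norm_nonneg _) (by positivity))
    refine (add_le_add hZ1 hZ1').trans ?_
    calc 4 * B ^ 5 * p * (1 + ρ) * q1 ^ 2 * (B * q2) +
          5 * B ^ 4 * p * (1 + ρ) * q1 * (B * q2 ^ 2)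
      _ = 4 * B ^ 6 * p * (1 + ρ) * (q1 ^ 2 * q2) +
          5 * B ^ 5 * p * (1 + ρ) * (q1 * q2 ^ 2) := by ring
      _ ≤ 4 * B ^ 6 * p * (1 + ρ) * (q ^ 2 * q) +
          5 * B ^ 6 * p * (1 + ρ) * (q * q ^ 2) := by
          gcongr
          norm_num
      _ = _ := by ring
  have := norm_dyadicSum_sub_le (θ := 3 * α) (by linarith [h.lt_alpha]) (by positivity) hab key m
  rw [rpow_three_mul_of_nonneg (by linarith)] at this
  refine this.trans_eq ?_
  ring

end IsCoeffControlled

end Composition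

/-! ### Local estimates for mild solutions -/

section MildBounds

variable {V W : Type*} [NormedAddCommGroup V] [NormedSpace ℝ V]
  [NormedAddCommGroup W] [NormedSpace ℝ W] {T α : ℝ}

/-- The operators `S_{t-u}` on `D(A²)`, as a family indexed by `u`. -/
def convOp (S : C0Semigroup W) (t u : ℝ) : S.domPow 2 →L[ℝ] W :=
  (S.op (t - u)).comp (S.incl 2)

section convOp

variable {S : C0Semigroup W} {B s t u v : ℝ}

theorem norm_convOp_le (hS : ∀ t ∈ Icc 0 T, ‖S.op t‖ ≤ B) (hB : 0 ≤ B) (hu : 0 ≤ u)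
    (hut : u ≤ t) (ht : t ≤ T) : ‖convOp S t u‖ ≤ B := by
  refine ContinuousLinearMap.opNorm_le_bound _ hB fun x => ?_
  refine ((S.op (t - u)).le_of_opNorm_le (hS _ ⟨by linarith, by linarith⟩) _).trans ?_
  gcongr
  exact C0Semigroup.norm_incl_apply_le x

theorem norm_convOp_sub_le (hS : ∀ t ∈ Icc 0 T, ‖S.op t‖ ≤ B) (hB : 0 ≤ B) (hu : 0 ≤ u)
    (huv : u ≤ v) (hvt : v ≤ t) (ht : t ≤ T) :
    ‖convOp S t v - convOp S t u‖ ≤ B ^ 2 * (v - u) := by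
  have h0 : 0 ≤ v - u := by linarith
  refine ContinuousLinearMap.opNorm_le_bound _ (by positivity) fun x => ?_
  have := C0Semigroup.norm_op_sub_op_incl_le hS hB x (s := t - v) (t := t - u) (by linarith)
    (by linarith) (by linarith)
  rw [norm_sub_rev] at this
  refine this.trans_eq ?_
  ring

theorem norm_convOp_diff_le (hS : ∀ t ∈ Icc 0 T, ‖S.op t‖ ≤ B) (hB : 0 ≤ B) (hu : 0 ≤ u)
    (hus : u ≤ s) (hst : s ≤ t) (ht : t ≤ T) :
    ‖convOp S t u - convOp S s u‖ ≤ B ^ 2 * (t - s) := by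
  have h0 : 0 ≤ t - s := by linarith
  refine ContinuousLinearMap.opNorm_le_bound _ (by positivity) fun x => ?_
  have := C0Semigroup.norm_op_sub_op_incl_le hS hB x (s := s - u) (t := t - u) (by linarith)
    (by linarith) (by linarith)
  refine this.trans_eq ?_
  ring

theorem norm_convOp_diff_sub_le (hS : ∀ t ∈ Icc 0 T, ‖S.op t‖ ≤ B) (hB : 0 ≤ B) (hu : 0 ≤ u)
    (huv : u ≤ v) (hvs : v ≤ s) (hst : s ≤ t) (ht : t ≤ T) :
    ‖(convOp S t v - convOp S s v) - (convOp S t u - convOp S s u)‖ ≤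
      B ^ 3 * (t - s) * (v - u) := by
  have h0 : 0 ≤ t - s := by linarith
  have h1 : 0 ≤ v - u := by linarith
  refine ContinuousLinearMap.opNorm_le_bound _ (by positivity) fun x => ?_
  have := C0Semigroup.norm_op_sub_op_sub_incl_le hS hB x (a := s - v) (p := t - s) (q := v - u)
    ⟨by linarith, by linarith⟩ ⟨by linarith, by linarith⟩ ⟨by linarith, by linarith⟩
  refine le_trans (le_of_eq ?_) this
  have e1 : s - v + (t - s) + (v - u) = t - u := by ring
  have e2 : s - v + (t - s) = t - v := by ring
  have e3 : s - v + (v - u) = s - u := by ring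
  rw [e1, e2, e3, ← norm_neg]
  congr 1
  simp only [convOp, _root_.sub_apply, ContinuousLinearMap.comp_apply]
  abel

end convOp

variable [CompleteSpace W]

/-- `Y` satisfies the mild equation, and a single constant `B` bounds all of its data. -/
structure IsBoundedMild (X : RoughPath V T α) (B : ℝ) (S : C0Semigroup W) (ξ : S.domPow 1)
    (f₀ : ℝ → W → S.domPow 1) (f : ℝ → W → V →L[ℝ] S.domPow 2) (Y : ℝ → W)
    (Y' : ℝ → V →L[ℝ] W) : Prop extends IsCoeffControlled X B (S.incl 2) f Y Y' where
  op_le : ∀ t ∈ Icc 0 T, ‖S.op t‖ ≤ B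
  init_le : ‖ξ‖ ≤ B
  drift_le : ∀ t ∈ Icc 0 T, ∀ y, ‖f₀ t y‖ ≤ B * (1 + ‖y‖)
  continuousOn_drift : ContinuousOn (fun s => S.incl 1 (f₀ s (Y s))) (Icc 0 T)
  exists_remainderBound : ∃ ρ, 0 ≤ ρ ∧ RemainderBound α X.path Y Y' 0 T ρ
  mild : ∀ t ∈ Icc 0 T, ∃ N : W,
    HasRoughIntegral X (fun s => (convOp S t s).comp (f s (Y s)))
      (fun s => (ContinuousLinearMap.compL ℝ V (S.domPow 2) W (convOp S t s)).comp
        ((fderiv ℝ (f s) (Y s)).comp (Y' s))) 0 t N ∧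
    Y t = S.op t (S.incl 1 ξ) + (∫ s in (0 : ℝ)..t, S.op (t - s) (S.incl 1 (f₀ s (Y s)))) + N

/-- The constant of the sewing estimate for the compositions `f(Y)`. -/
def sewingConst (α B : ℝ) : ℝ := 9 * B ^ 6 * (1 - 2 ^ (1 - 3 * α))⁻¹

theorem sewingConst_nonneg {B : ℝ} (hα : 1 / 3 < α) : 0 ≤ sewingConst α B := by
  have : (2 : ℝ) ^ (1 - 3 * α) < 1 :=
    Real.rpow_lt_one_of_one_lt_of_neg one_lt_two (by linarith)
  have : 0 < 1 - (2 : ℝ) ^ (1 - 3 * α) := by linarith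
  rw [sewingConst]
  positivity

namespace IsBoundedMild

variable {X : RoughPath V T α} {B : ℝ} {S : C0Semigroup W} {ξ : S.domPow 1}
  {f₀ : ℝ → W → S.domPow 1} {f : ℝ → W → V →L[ℝ] S.domPow 2} {Y : ℝ → W}
  {Y' : ℝ → V →L[ℝ] W} {s t τ ρ K c : ℝ}

variable (h : IsBoundedMild X B S ξ f₀ f Y Y')
include h

theorem norm_drift_sub_le (hs : 0 ≤ s) (hst : s ≤ t) (ht : t ≤ T)
    (hc : ∀ u ∈ Icc 0 t, ‖f₀ u (Y u)‖ ≤ c) :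
    ‖(∫ u in (0 : ℝ)..t, S.op (t - u) (S.incl 1 (f₀ u (Y u)))) -
      ∫ u in (0 : ℝ)..s, S.op (s - u) (S.incl 1 (f₀ u (Y u)))‖ ≤ 2 * B ^ 3 * c * (t - s) := by
  have hB := h.nonneg
  have hB1 := h.one_le
  have hTB := h.time_le
  have hc0 : 0 ≤ c := (norm_nonneg _).trans (hc 0 ⟨le_rfl, hs.trans hst⟩)
  have hφt := C0Semigroup.continuousOn_op_sub_apply h.op_le ht
    (h.continuousOn_drift.mono (Icc_subset_Icc_right ht))
  have hφs := C0Semigroup.continuousOn_op_sub_apply h.op_le (hst.trans ht)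
    (h.continuousOn_drift.mono (Icc_subset_Icc_right (hst.trans ht)))
  have hi1 : IntervalIntegrable (fun u => S.op (t - u) (S.incl 1 (f₀ u (Y u))))
      MeasureTheory.volume 0 s :=
    (hφt.mono (Icc_subset_Icc_right hst)).intervalIntegrable_of_Icc hs
  have hi2 : IntervalIntegrable (fun u => S.op (t - u) (S.incl 1 (f₀ u (Y u))))
      MeasureTheory.volume s t :=
    (hφt.mono (Icc_subset_Icc_left hs)).intervalIntegrable_of_Icc hst
  have hi3 : IntervalIntegrable (fun u => S.op (s - u) (S.incl 1 (f₀ u (Y u))))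
      MeasureTheory.volume 0 s := hφs.intervalIntegrable_of_Icc hs
  rw [← intervalIntegral.integral_add_adjacent_intervals hi1 hi2, add_sub_right_comm,
    ← intervalIntegral.integral_sub hi1 hi3]
  have h1 := intervalIntegral.norm_integral_le_of_norm_le_const (a := 0) (b := s)
    (f := fun u => S.op (t - u) (S.incl 1 (f₀ u (Y u))) - S.op (s - u) (S.incl 1 (f₀ u (Y u))))
    (C := B ^ 2 * (t - s) * c) fun u hu => by
      rw [uIoc_of_le hs] at hu
      refine (C0Semigroup.norm_op_sub_op_incl_le (n := 0) h.op_le hB (f₀ u (Y u)) (s := s - u)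
        (t := t - u) (by linarith [hu.2]) (by linarith) (by linarith [hu.1])).trans ?_
      have : t - u - (s - u) = t - s := by ring
      rw [this]
      have : 0 ≤ t - s := by linarith
      gcongr
      exact hc u ⟨hu.1.le, hu.2.trans hst⟩
  have h2 := intervalIntegral.norm_integral_le_of_norm_le_const (a := s) (b := t)
    (f := fun u => S.op (t - u) (S.incl 1 (f₀ u (Y u)))) (C := B * c) fun u hu => by
      rw [uIoc_of_le hst] at hu
      refine ((S.op _).le_of_opNorm_le (h.op_le (t - u)
        ⟨by linarith [hu.2], by linarith [hu.1]⟩) _).trans ?_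
      gcongr
      exact (C0Semigroup.norm_incl_apply_le _).trans (hc u ⟨by linarith [hu.1], hu.2⟩)
  rw [abs_of_nonneg (by linarith)] at h1 h2
  refine (norm_add_le _ _).trans ((add_le_add h1 h2).trans ?_)
  have hts : 0 ≤ t - s := by linarith
  calc B ^ 2 * (t - s) * c * (s - 0) + B * c * (t - s)
    _ ≤ B ^ 2 * (t - s) * c * B + B ^ 3 * c * (t - s) := by
        have : B ≤ B ^ 3 := le_self_pow₀ hB1 (by norm_num)
        gcongr
        linarith
    _ = _ := by ring

/-- The germ over one interval differs from `f(s, Y_s) X_{s,t}` by terms of order `2α`. -/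
theorem norm_operatorGerm_sub_le (hs : 0 ≤ s) (hst : s ≤ t) (ht : t ≤ T) :
    ‖operatorGerm X f Y Y' (convOp S t) s t - Y' s (X.path t - X.path s)‖ ≤
      B ^ 3 * (t - s) * (t - s) ^ α + B ^ 4 * ((t - s) ^ α) ^ 2 := by
  have hB := h.nonneg
  have hs' : s ∈ Icc 0 T := ⟨hs, hst.trans ht⟩
  have hts : 0 ≤ t - s := by linarith
  set x := X.path t - X.path s with hx
  have h1 : ‖f s (Y s) x‖ ≤ B * (B * (t - s) ^ α) :=
    ContinuousLinearMap.le_of_opNorm_le_of_le _ (h.coeff.norm_le s hs' _) (h.path s t hs hst ht)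
  have h2 := C0Semigroup.norm_op_sub_incl_le (n := 1) h.op_le hB (f s (Y s) x)
    (t := t - s) ⟨hts, by linarith⟩
  have h3 := norm_tensorLift_apply_le ((ContinuousLinearMap.compL ℝ V (S.domPow 2) W
    (convOp S t s)).comp ((fderiv ℝ (f s) (Y s)).comp (Y' s))) (X.area s t)
  have h4 := (norm_compL_comp_le (convOp S t s) ((fderiv ℝ (f s) (Y s)).comp (Y' s))).trans
    (mul_le_mul (norm_convOp_le h.op_le hB hs hst ht) (h.norm_comp_deriv_le hs')
      (ContinuousLinearMap.opNorm_nonneg _) hB)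
  have h5 := h.area s t hs hst ht
  have e : operatorGerm X f Y Y' (convOp S t) s t - Y' s x =
      (S.op (t - s) (S.incl 2 (f s (Y s) x)) - S.incl 2 (f s (Y s) x)) +
      tensorLift ((ContinuousLinearMap.compL ℝ V (S.domPow 2) W
        (convOp S t s)).comp ((fderiv ℝ (f s) (Y s)).comp (Y' s))) (X.area s t) := by
    have hy : Y' s x = S.incl 2 (f s (Y s) x) := by rw [h.deriv_eq s hs']; rfl
    rw [hy]
    simp only [operatorGerm, roughGerm, convOp, ContinuousLinearMap.comp_apply,
      ← hx]
    abel
  rw [e]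
  refine (norm_add_le _ _).trans ?_
  calc _ ≤ B * (t - s) * (B * (B * (t - s) ^ α)) + B * B ^ 2 * (B * ((t - s) ^ α) ^ 2) := by
        refine add_le_add (h2.trans ?_) (h3.trans ?_)
        · gcongr
        · exact mul_le_mul h4 h5 (norm_nonneg _) (by positivity)
    _ = _ := by ring

/-- The increment of the rough convolution over `[s,t]`. On `[0,s]` the integrand is
`(S_{t-u} - S_{s-u}) f(u, Y_u)`, of size `t - s`; the interval is cut at `τ` so that the bound `K`
for the past and the bound `ρ` for the current step enter separately. -/
theorem norm_rough_sub_le {N N' : W} (hK : 0 ≤ K) (hρ : 0 ≤ ρ) (hτ : 0 ≤ τ) (hτs : τ ≤ s)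
    (hst : s ≤ t) (ht : t ≤ T)
    (hN : HasRoughIntegral X (fun s => (convOp S t s).comp (f s (Y s)))
      (fun s => (ContinuousLinearMap.compL ℝ V (S.domPow 2) W (convOp S t s)).comp
        ((fderiv ℝ (f s) (Y s)).comp (Y' s))) 0 t N)
    (hN' : HasRoughIntegral X (fun u => (convOp S s u).comp (f u (Y u)))
      (fun u => (ContinuousLinearMap.compL ℝ V (S.domPow 2) W (convOp S s u)).comp
        ((fderiv ℝ (f u) (Y u)).comp (Y' u))) 0 s N')
    (hRK : RemainderBound α X.path Y Y' 0 τ K) (hRρ : RemainderBound α X.path Y Y' τ t ρ) :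
    ‖N - N' - Y' s (X.path t - X.path s)‖ ≤
      B ^ 3 * (t - s) * (2 * B ^ 5 + sewingConst α B * (1 + K) * (τ ^ α) ^ 3) +
      B ^ 3 * (t - s) * (2 * B ^ 5 + sewingConst α B * (1 + ρ) * ((s - τ) ^ α) ^ 3) +
      B ^ 2 * sewingConst α B * (1 + ρ) * ((t - s) ^ α) ^ 3 +
      (B ^ 3 * (t - s) * (t - s) ^ α + B ^ 4 * ((t - s) ^ α) ^ 2) := by
  have hB := h.nonneg
  have hB1 := h.one_le
  have hs : 0 ≤ s := hτ.trans hτs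
  have hsT : s ≤ T := hst.trans ht
  have hts : 0 ≤ t - s := by linarith
  set P : ℝ → S.domPow 2 →L[ℝ] W := fun u => convOp S t u - convOp S s u with hP
  have hp : 0 ≤ B ^ 3 * (t - s) := by positivity
  have hPle : ∀ u, 0 ≤ u → u ≤ s → ‖P u‖ ≤ B ^ 3 * (t - s) := fun u hu hus =>
    (norm_convOp_diff_le h.op_le hB hu hus hst ht).trans (by gcongr; norm_num)
  have hPlip : ∀ u v, 0 ≤ u → u ≤ v → v ≤ s → ‖P v - P u‖ ≤ B ^ 3 * (t - s) * (v - u) :=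
    fun u v hu huv hvs => norm_convOp_diff_sub_le h.op_le hB hu huv hvs hst ht
  have h1 := h.norm_dyadicSum_operatorGerm_sub_le hK le_rfl hτ (hτs.trans hsT) hp
    (fun u hu hu' => hPle u hu (hu'.trans hτs))
    (fun u v hu huv hv => hPlip u v hu huv (hv.trans hτs)) hRK
  have h1' := h.norm_operatorGerm_le le_rfl hτ (hτs.trans hsT) (hPle 0 le_rfl hs)
  have h2 := h.norm_dyadicSum_operatorGerm_sub_le hρ hτ hτs hsT hp
    (fun u hu hu' => hPle u (hτ.trans hu) hu')
    (fun u v hu huv hv => hPlip u v (hτ.trans hu) huv hv)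
    (fun a b ha hab hb => hRρ a b ha hab (hb.trans hst))
  have h2' := h.norm_operatorGerm_le hτ hτs hsT (hPle τ hτ hτs)
  have h3 := h.norm_dyadicSum_operatorGerm_sub_le hρ hs hst ht (sq_nonneg B)
    (fun u hu hu' => (norm_convOp_le h.op_le hB (hs.trans hu) hu' ht).trans
      (le_self_pow₀ hB1 (by norm_num)))
    (fun u v hu huv hv => norm_convOp_sub_le h.op_le hB (hs.trans hu) huv hv ht)
    (fun a b ha hab hb => hRρ a b (hτs.trans ha) hab hb)
  have h4 := h.norm_operatorGerm_sub_le hs hst ht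
  rw [sub_zero] at h1
  have key := norm_limit_sub_limit_le
    (operatorGerm_sub (X := X) (f := f) (Y := Y) (Y' := Y') (convOp S t) (convOp S s) P
      fun _ => rfl) (operatorGerm_self _ ⟨hs, hsT⟩) (hN.tendsto_dyadicSum hτ hτs hst ht)
    (hN'.tendsto_dyadicSum hτ hτs le_rfl hsT)
    (fun m => (norm_le_norm_sub_add _ _).trans (add_le_add (h1 m) h1'))
    (fun m => (norm_le_norm_sub_add _ _).trans (add_le_add (h2 m) h2'))
    (fun m => (norm_sub_le_norm_sub_add_norm_sub _ _ _).trans (add_le_add (h3 m) h4))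
  refine key.trans_eq ?_
  rw [sewingConst]
  ring

end IsBoundedMild

end MildBounds

/-! ### Propagation of the bounds over a short time step -/

section Step

/-- The part of the remainder estimate on a time step that comes from the bound `K` on the past. -/
def pastConst (α B K : ℝ) : ℝ :=
  B ^ 3 + 2 * B ^ 4 * (1 + K + B ^ 2) +
    B ^ 3 * (2 * B ^ 5 + sewingConst α B * (1 + K) * B ^ 3) +
    B ^ 3 * (2 * B ^ 5 + sewingConst α B) + B ^ 2 * sewingConst α B + B ^ 3 + B ^ 4

/-- The factor in front of `ρ η^α` in the remainder estimate on a time step of length `η`. -/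
def stepConst (α B : ℝ) : ℝ :=
  2 * B ^ 4 + B ^ 3 * sewingConst α B + B ^ 2 * sewingConst α B

/-- The bound at the end of a time step, in terms of the bound `K` at its beginning. -/
def nextBound (α B K : ℝ) : ℝ :=
  K + 2 * pastConst α B K + B ^ 2 + B ^ 3 + B ^ 4 + B ^ 3 * K

theorem pastConst_nonneg {α B K : ℝ} (hα : 1 / 3 < α) (hB : 0 ≤ B) (hK : 0 ≤ K) :
    0 ≤ pastConst α B K := by
  have := sewingConst_nonneg (B := B) hα
  rw [pastConst]
  positivity

theorem nextBound_nonneg {α B K : ℝ} (hα : 1 / 3 < α) (hB : 0 ≤ B) (hK : 0 ≤ K) :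
    0 ≤ nextBound α B K := by
  have := pastConst_nonneg hα hB hK
  rw [nextBound]
  positivity

variable {V W : Type*} [NormedAddCommGroup V] [NormedSpace ℝ V]
  [NormedAddCommGroup W] [NormedSpace ℝ W] [CompleteSpace W] {T α : ℝ}

namespace IsBoundedMild

variable {X : RoughPath V T α} {B : ℝ} {S : C0Semigroup W} {ξ : S.domPow 1}
  {f₀ : ℝ → W → S.domPow 1} {f : ℝ → W → V →L[ℝ] S.domPow 2} {Y : ℝ → W}
  {Y' : ℝ → V →L[ℝ] W} {s t τ η ρ K : ℝ}

theorem rpow_bounds_of_le (hα : 1 / 3 < α) (hα' : α < 1 / 2) (hη1 : η ≤ 1) {x : ℝ} (hx : 0 ≤ x)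
    (hxη : x ≤ η) : 0 ≤ x ^ α ∧ x ^ α ≤ η ^ α ∧ η ^ α ≤ 1 ∧ x ≤ (x ^ α) ^ 2 := by
  refine ⟨Real.rpow_nonneg hx _, Real.rpow_le_rpow hx hxη (by linarith),
    Real.rpow_le_one (hx.trans hxη) hη1 (by linarith), ?_⟩
  rw [← rpow_two_mul_of_nonneg hx]
  calc x = x ^ (1 : ℝ) := (Real.rpow_one x).symm
    _ ≤ x ^ (2 * α) := Real.rpow_le_rpow_of_exponent_ge_of_imp hx (hxη.trans hη1) (by linarith)
        (by intro _ h; linarith)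

variable (h : IsBoundedMild X B S ξ f₀ f Y Y')
include h

theorem norm_le_of_remainderBound (hρ : 0 ≤ ρ) (hτ : 0 ≤ τ) (hη : 0 ≤ η) (hη1 : η ≤ 1)
    (hτη : τ + η ≤ T) (hY : ∀ u ∈ Icc 0 τ, ‖Y u‖ ≤ K)
    (hRρ : RemainderBound α X.path Y Y' τ (τ + η) ρ) {u : ℝ} (hu : u ∈ Icc 0 (τ + η)) :
    ‖Y u‖ ≤ K + B ^ 2 + ρ * η ^ α := by
  rcases le_total u τ with huτ | hτu
  · have h1 := hY u ⟨hu.1, huτ⟩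
    have : 0 ≤ ρ * η ^ α := mul_nonneg hρ (Real.rpow_nonneg hη _)
    nlinarith
  · obtain ⟨hq0, hqη, hη1', -⟩ := rpow_bounds_of_le h.lt_alpha h.alpha_lt hη1
      (x := u - τ) (by linarith) (by linarith [hu.2])
    have h1 := h.norm_increment_le hτ hτu (hu.2.trans hτη) (hRρ τ u le_rfl hτu hu.2)
    have h2 := hY τ ⟨hτ, le_rfl⟩
    have h3 : ‖Y u‖ ≤ ‖Y τ‖ + ‖Y u - Y τ‖ := by
      rw [add_comm]; exact norm_le_norm_sub_add _ _
    have hB := h.nonneg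
    have h4 : B ^ 2 * (u - τ) ^ α ≤ B ^ 2 * 1 := by gcongr; exact hqη.trans hη1'
    have h5 : ρ * ((u - τ) ^ α) ^ 2 ≤ ρ * η ^ α := by
      gcongr
      nlinarith
    linarith

/-- On a time step of length `η` a bound `ρ` on the remainder improves to
`pastConst + stepConst * η^α * ρ`. -/
theorem remainderBound_improve (hK : 0 ≤ K) (hρ : 0 ≤ ρ) (hτ : 0 ≤ τ) (hη : 0 ≤ η) (hη1 : η ≤ 1)
    (hτη : τ + η ≤ T) (hY : ∀ u ∈ Icc 0 τ, ‖Y u‖ ≤ K)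
    (hRK : RemainderBound α X.path Y Y' 0 τ K)
    (hRρ : RemainderBound α X.path Y Y' τ (τ + η) ρ) :
    RemainderBound α X.path Y Y' τ (τ + η) (pastConst α B K + stepConst α B * η ^ α * ρ) := by
  intro s t hτs hst htη
  have hB := h.nonneg
  have hB1 := h.one_le
  have hA := sewingConst_nonneg (B := B) h.lt_alpha
  have hs : 0 ≤ s := hτ.trans hτs
  have ht : t ≤ T := htη.trans hτη
  have hts : 0 ≤ t - s := by linarith
  obtain ⟨hq0, hqη, hη1', hdq⟩ := rpow_bounds_of_le h.lt_alpha h.alpha_lt hη1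
    (x := t - s) hts (by linarith)
  obtain ⟨hr0, hrη, -, -⟩ := rpow_bounds_of_le h.lt_alpha h.alpha_lt hη1
    (x := s - τ) (by linarith) (by linarith)
  have hτB : τ ^ α ≤ B := by
    have := h.rpow_le le_rfl hτ (by linarith)
    rwa [sub_zero] at this
  have hτ0 : 0 ≤ τ ^ α := Real.rpow_nonneg hτ _
  obtain ⟨N, hN, hYt⟩ := h.mild t ⟨hs.trans hst, ht⟩
  obtain ⟨N', hN', hYs⟩ := h.mild s ⟨hs, hst.trans ht⟩
  have h1 := h.norm_rough_sub_le hK hρ hτ hτs hst ht hN hN' hRK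
    (fun a b ha hab hb => hRρ a b ha hab (hb.trans htη))
  have h2 := h.norm_drift_sub_le hs hst ht (c := B * (1 + (K + B ^ 2 + ρ * η ^ α)))
    (fun u hu => (h.drift_le u ⟨hu.1, hu.2.trans ht⟩ _).trans (by
      gcongr
      exact h.norm_le_of_remainderBound hρ hτ hη hη1 hτη hY hRρ ⟨hu.1, hu.2.trans htη⟩))
  have h3 := C0Semigroup.norm_op_sub_op_incl_le (n := 0) h.op_le hB ξ hs hst ht
  have e : Y t - Y s - Y' s (X.path t - X.path s) =
      (S.op t (S.incl 1 ξ) - S.op s (S.incl 1 ξ)) +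
      ((∫ u in (0 : ℝ)..t, S.op (t - u) (S.incl 1 (f₀ u (Y u)))) -
        ∫ u in (0 : ℝ)..s, S.op (s - u) (S.incl 1 (f₀ u (Y u)))) +
      (N - N' - Y' s (X.path t - X.path s)) := by
    nth_rw 1 [hYt]
    nth_rw 1 [hYs]
    abel
  rw [e]
  refine norm_add₃_le.trans ((add_le_add (add_le_add h3 h2) h1).trans ?_)
  set H := η ^ α
  set q := (t - s) ^ α
  set r := (s - τ) ^ α
  set A := sewingConst α B
  have hH0 : 0 ≤ H := hq0.trans hqη
  have hq1 : q ≤ 1 := hqη.trans hη1'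
  have hr3 : r ^ 3 ≤ H :=
    calc r ^ 3 ≤ H ^ 3 := by gcongr
      _ ≤ H := pow_le_of_le_one hH0 hη1' (by norm_num)
  have hq3 : q ^ 3 ≤ H * q ^ 2 := by
    rw [pow_succ']
    gcongr
  have hξ := h.init_le
  calc B ^ 2 * (t - s) * ‖ξ‖ + 2 * B ^ 3 * (B * (1 + (K + B ^ 2 + ρ * H))) * (t - s) +
        (B ^ 3 * (t - s) * (2 * B ^ 5 + A * (1 + K) * (τ ^ α) ^ 3) +
          B ^ 3 * (t - s) * (2 * B ^ 5 + A * (1 + ρ) * r ^ 3) +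
          B ^ 2 * A * (1 + ρ) * q ^ 3 + (B ^ 3 * (t - s) * q + B ^ 4 * q ^ 2))
    _ ≤ B ^ 2 * q ^ 2 * B + 2 * B ^ 3 * (B * (1 + (K + B ^ 2 + ρ * H))) * q ^ 2 +
        (B ^ 3 * q ^ 2 * (2 * B ^ 5 + A * (1 + K) * B ^ 3) +
          B ^ 3 * q ^ 2 * (2 * B ^ 5 + A * (1 + ρ) * H) +
          B ^ 2 * A * (1 + ρ) * (H * q ^ 2) + (B ^ 3 * q ^ 2 * 1 + B ^ 4 * q ^ 2)) := by
        gcongr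
    _ = (B ^ 3 + 2 * B ^ 4 * (1 + K + B ^ 2) +
          B ^ 3 * (2 * B ^ 5 + A * (1 + K) * B ^ 3) +
          B ^ 3 * (2 * B ^ 5 + A * H) + B ^ 2 * A * H + B ^ 3 + B ^ 4 +
          (2 * B ^ 4 + B ^ 3 * A + B ^ 2 * A) * H * ρ) * q ^ 2 := by ring
    _ ≤ (B ^ 3 + 2 * B ^ 4 * (1 + K + B ^ 2) +
          B ^ 3 * (2 * B ^ 5 + A * (1 + K) * B ^ 3) +
          B ^ 3 * (2 * B ^ 5 + A * 1) + B ^ 2 * A * 1 + B ^ 3 + B ^ 4 +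
          (2 * B ^ 4 + B ^ 3 * A + B ^ 2 * A) * H * ρ) * q ^ 2 := by gcongr
    _ = _ := by rw [pastConst, stepConst]; ring

/-- If the time step `η` is short, depending on `α` and `B` only, then the bound `ρ` for the current
step is absorbed, and the bounds extend from `[0,τ]` to `[0,τ+η]`. -/
theorem bounds_extend (hη : 0 ≤ η) (hη1 : η ≤ 1) (hηs : stepConst α B * η ^ α ≤ 1 / 2)
    (hK : 0 ≤ K) (hτ : 0 ≤ τ) (hτη : τ + η ≤ T) (hY : ∀ u ∈ Icc 0 τ, ‖Y u‖ ≤ K)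
    (hRK : RemainderBound α X.path Y Y' 0 τ K) :
    (∀ u ∈ Icc 0 (τ + η), ‖Y u‖ ≤ nextBound α B K) ∧
      RemainderBound α X.path Y Y' 0 (τ + η) (nextBound α B K) := by
  have hB := h.nonneg
  have hc := pastConst_nonneg h.lt_alpha hB hK
  obtain ⟨ρ₀, hρ₀, hR₀⟩ := h.exists_remainderBound
  have hR : RemainderBound α X.path Y Y' τ (τ + η) (2 * pastConst α B K) := by
    refine RemainderBound.of_improvement (ρ := ρ₀)
      (fun s t hs hst ht => hR₀ s t (hτ.trans hs) hst (ht.trans hτη)) hρ₀ hc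
      fun ρ hρ hRρ s t hs hst ht => ?_
    refine (h.remainderBound_improve hK hρ hτ hη hη1 hτη hY hRK hRρ s t hs hst ht).trans ?_
    gcongr
    nlinarith
  have hη1' : η ^ α ≤ 1 := Real.rpow_le_one hη hη1 (by linarith [h.lt_alpha])
  have hnext : nextBound α B K =
    K + 2 * pastConst α B K + B ^ 2 + B ^ 3 + B ^ 4 + B ^ 3 * K := rfl
  have hB2 := pow_nonneg hB 2
  have hB3 := pow_nonneg hB 3
  have hB4 := pow_nonneg hB 4
  have hBK := mul_nonneg hB3 hK
  refine ⟨fun u hu => ?_, fun s t hs hst ht => ?_⟩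
  · refine (h.norm_le_of_remainderBound (by positivity) hτ hη hη1 hτη hY hR hu).trans ?_
    nlinarith
  have hq0 : 0 ≤ (t - s) ^ α := Real.rpow_nonneg (by linarith) _
  rcases le_total t τ with htτ | hτt
  · refine (hRK s t hs hst htτ).trans ?_
    gcongr
    linarith
  rcases le_total τ s with hτs | hsτ
  · refine (hR s t hτs hst ht).trans ?_
    gcongr
    linarith
  -- the remainder over `[s,t]` with `s ≤ τ ≤ t` is the sum of those over `[s,τ]` and `[τ,t]`, up to
  -- the increment of `Y'`
  have hτT : τ ≤ T := by linarith
  have h1 := hRK s τ hs hsτ le_rfl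
  have h2 := hR τ t le_rfl hτt ht
  have h3 := h.norm_increment_le hs hsτ hτT h1
  have h4 := h.norm_deriv_sub_le hs hsτ hτT
  have h5 := h.path τ t hτ hτt (ht.trans hτη)
  have h6 := h.rpow_le hs hsτ hτT
  have ha : (τ - s) ^ α ≤ (t - s) ^ α :=
    Real.rpow_le_rpow (by linarith) (by linarith) (by linarith [h.lt_alpha])
  have hb : (t - τ) ^ α ≤ (t - s) ^ α :=
    Real.rpow_le_rpow (by linarith) (by linarith) (by linarith [h.lt_alpha])
  have ha0 : 0 ≤ (τ - s) ^ α := Real.rpow_nonneg (by linarith) _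
  have hb0 : 0 ≤ (t - τ) ^ α := Real.rpow_nonneg (by linarith) _
  have e : Y t - Y s - Y' s (X.path t - X.path s) =
      (Y τ - Y s - Y' s (X.path τ - X.path s)) + (Y t - Y τ - Y' τ (X.path t - X.path τ)) +
      (Y' τ - Y' s) (X.path t - X.path τ) := by
    simp only [map_sub, _root_.sub_apply]
    abel
  set q := (t - s) ^ α
  set a := (τ - s) ^ α
  set b := (t - τ) ^ α
  have h7 : ‖Y' τ - Y' s‖ ≤ (B ^ 2 + B ^ 3 + B ^ 2 * K) * a :=
    calc ‖Y' τ - Y' s‖ ≤ B * a ^ 2 + B * (B ^ 2 * a + K * a ^ 2) := h4.trans (by gcongr)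
      _ = (B * a + B ^ 3 + B * K * a) * a := by ring
      _ ≤ (B * B + B ^ 3 + B * K * B) * a := by gcongr
      _ = _ := by ring
  have h8 := ContinuousLinearMap.le_of_opNorm_le_of_le _ h7 h5
  rw [e]
  refine norm_add₃_le.trans ((add_le_add (add_le_add h1 h2) h8).trans ?_)
  calc K * a ^ 2 + 2 * pastConst α B K * b ^ 2 + (B ^ 2 + B ^ 3 + B ^ 2 * K) * a * (B * b)
    _ ≤ K * q ^ 2 + 2 * pastConst α B K * q ^ 2 + (B ^ 2 + B ^ 3 + B ^ 2 * K) * q * (B * q) := by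
        gcongr
    _ = (K + 2 * pastConst α B K + B ^ 3 + B ^ 4 + B ^ 3 * K) * q ^ 2 := by ring
    _ ≤ nextBound α B K * q ^ 2 := by
        gcongr
        linarith

theorem norm_zero_le (hT : 0 ≤ T) : ‖Y 0‖ ≤ B := by
  obtain ⟨N, hN, hY⟩ := h.mild 0 ⟨le_rfl, hT⟩
  rw [hY, hN.eq_zero]
  simpa [S.op_zero] using (C0Semigroup.norm_incl_apply_le ξ).trans h.init_le

theorem bounds_iterate (hη : 0 ≤ η) (hη1 : η ≤ 1) (hηs : stepConst α B * η ^ α ≤ 1 / 2) (n : ℕ)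
    (hn : n * η ≤ T) :
    (∀ u ∈ Icc 0 (n * η), ‖Y u‖ ≤ (nextBound α B)^[n] B) ∧
      RemainderBound α X.path Y Y' 0 (n * η) ((nextBound α B)^[n] B) := by
  have hB := h.nonneg
  have hpos : ∀ n : ℕ, 0 ≤ (nextBound α B)^[n] B := by
    intro n
    induction n with
    | zero => exact hB
    | succ n ih =>
      rw [Function.iterate_succ_apply']
      exact nextBound_nonneg h.lt_alpha hB ih
  induction n with
  | zero =>
    simp only [Nat.cast_zero, zero_mul, Function.iterate_zero, id] at hn ⊢
    refine ⟨fun u hu => ?_, fun s t hs hst ht => ?_⟩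
    · rw [le_antisymm hu.2 hu.1]
      exact h.norm_zero_le hn
    · have h1 : t = 0 := le_antisymm ht (hs.trans hst)
      have h2 : s = 0 := le_antisymm (hst.trans ht) hs
      subst h1 h2
      simp only [sub_self, map_zero, norm_zero]
      positivity
  | succ n ih =>
    rw [Nat.cast_succ, add_mul, one_mul] at hn ⊢
    rw [Function.iterate_succ_apply']
    obtain ⟨hY, hR⟩ := ih (by linarith)
    exact h.bounds_extend hη hη1 hηs (hpos n) (by positivity) hn hY hR

end IsBoundedMild

end Step

/-! ### The a priori bound -/

theorem IsMildSolution.isBoundedMild {V W : Type*} [NormedAddCommGroup V] [NormedSpace ℝ V]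
    [NormedAddCommGroup W] [NormedSpace ℝ W] [CompleteSpace W] {α T : ℝ} (hα : 1 / 3 < α)
    (hα' : α < 1 / 2) {X : RoughPath V T α} {B : ℝ} {L₀ L C C' : ℝ≥0} (hB1 : 1 ≤ B) (hTB : T ≤ B)
    (hX : holderNorm T α X.path ≤ C) (hXX : holderNorm₂ T (2 * α) X.area ≤ C')
    (hC : C ≤ B) (hC' : C' ≤ B) (hL₀ : L₀ ≤ B) (hL : L ≤ B)
    {S : C0Semigroup W} (hS : ∀ t ∈ Icc 0 T, ‖S.op t‖ ≤ B) {ξ : S.domPow 1} (hξ : ‖ξ‖ ≤ B)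
    {f₀ : ℝ → W → S.domPow 1} (hf₀ : IsLip T f₀) (hf₀' : lipNorm T f₀ ≤ L₀)
    {f : ℝ → W → V →L[ℝ] S.domPow 2} (hf : IsCb T (2 * α) 2 f) (hf' : cbNorm T (2 * α) 2 f ≤ L)
    {Y : ℝ → W} {Y' : ℝ → V →L[ℝ] W} (h : IsMildSolution X S ξ f₀ f Y Y') :
    IsBoundedMild X B S ξ f₀ f Y Y' := by
  obtain ⟨⟨hY, -, hR⟩, hY', hmild⟩ := h
  have hα0 : 0 < α := by linarith
  have hcY := continuousOn_of_holderNorm_lt_top hα0 hY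
  refine ⟨⟨hα, hα', hB1, hTB, fun s t hs hst ht => ?_, fun s t hs hst ht => ?_,
    hf.coeffBounds (by linarith) hf' hL, C0Semigroup.norm_incl_apply_le, hY'⟩, hS, hξ,
    fun t ht y => ?_, ?_, ?_, hmild⟩
  · have := norm_sub_le_of_holderNorm_le hα0 hX (s := s) (t := t) ⟨hs, hst.trans ht⟩
      ⟨hs.trans hst, ht⟩
    rw [abs_of_nonneg (by linarith)] at this
    refine this.trans ?_
    have : 0 ≤ (t - s) ^ α := Real.rpow_nonneg (by linarith) _
    gcongr
  · rcases hst.eq_or_lt with rfl | hlt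
    · rw [X.area_self ⟨hs, ht⟩, norm_zero]
      positivity
    have := norm_le_of_holderNorm₂_le hXX (s := s) (t := t) ⟨hs, hst.trans ht⟩
      ⟨hs.trans hst, ht⟩ hlt.ne
    rw [abs_of_nonneg (by linarith), rpow_two_mul_of_nonneg (by linarith)] at this
    exact this.trans (by gcongr)
  · exact (norm_le_of_lipNorm_le hf₀' ht y).trans (by gcongr)
  · exact (S.incl 1).continuous.comp_continuousOn (hf₀.1.comp
      (continuousOn_id.prodMk hcY) fun s hs => ⟨hs, mem_univ _⟩)
  · lift holderNorm₂ T (2 * α) (fun s t => Y t - Y s - Y' s (X.path t - X.path s)) to ℝ≥0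
      using hR.ne with ρ hρ
    refine ⟨ρ, ρ.2, fun s t hs hst ht => ?_⟩
    rcases hst.eq_or_lt with rfl | hlt
    · simp only [sub_self, map_zero, norm_zero]
      positivity
    have := norm_le_of_holderNorm₂_le hρ.symm.le (s := s) (t := t) ⟨hs, hst.trans ht⟩
      ⟨hs.trans hst, ht⟩ hlt.ne
    rwa [abs_of_nonneg (by linarith), rpow_two_mul_of_nonneg (by linarith)] at this

theorem mainTheorem10 {V W : Type*} [NormedAddCommGroup V] [NormedSpace ℝ V] [CompleteSpace V]
    [NormedAddCommGroup W] [NormedSpace ℝ W] [CompleteSpace W]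
    (α T : ℝ) (hα : 1 / 3 < α) (hα' : α < 1 / 2) (hT : 0 < T) (X : RoughPath V T α)
    (M ω : ℝ) (hM : 1 ≤ M) (r L₀ L : ℝ≥0) :
    ∃ K : ℝ, 0 < K ∧ ∀ S : C0Semigroup W, (∀ t ≥ 0, ‖S.op t‖ ≤ M * Real.exp (ω * t)) →
      ∀ ξ : S.domPow 1, ‖ξ‖ ≤ r →
      ∀ f₀ : ℝ → W → S.domPow 1, IsLip T f₀ → lipNorm T f₀ ≤ L₀ →
      ∀ f : ℝ → W → V →L[ℝ] S.domPow 2, IsCb T (2 * α) 2 f → cbNorm T (2 * α) 2 f ≤ L →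
      ∀ (Y : ℝ → W) (Y' : ℝ → V →L[ℝ] W), IsMildSolution X S ξ f₀ f Y Y' →
      ∀ t ∈ Icc 0 T, ‖Y t‖ ≤ K := by
  obtain ⟨C, hC⟩ : ∃ C : ℝ≥0, holderNorm T α X.path = C :=
    ⟨_, (ENNReal.coe_toNNReal X.holder_path.ne).symm⟩
  obtain ⟨C', hC'⟩ : ∃ C : ℝ≥0, holderNorm₂ T (2 * α) X.area = C :=
    ⟨_, (ENNReal.coe_toNNReal X.holder_area.ne).symm⟩
  set m : ℝ := M * Real.exp (|ω| * T) with hm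
  have hm0 : 0 ≤ m := by positivity
  set B : ℝ := 1 + T + C + C' + r + L₀ + L + m with hB
  have hC0 := C.coe_nonneg
  have hC0' := C'.coe_nonneg
  have hr0 := r.coe_nonneg
  have hL₀0 := L₀.coe_nonneg
  have hL0 := L.coe_nonneg
  -- the number `n` of time steps is chosen so that the step `T / n` is short
  have hlim : Tendsto (fun n : ℕ => T / n) atTop (𝓝 0) := tendsto_const_div_atTop_nhds_zero_nat T
  have hlim' : Tendsto (fun n : ℕ => stepConst α B * (T / n) ^ α) atTop (𝓝 0) := by
    have := (hlim.rpow_const (p := α) (Or.inr (by linarith))).const_mul (stepConst α B)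
    rwa [Real.zero_rpow (by linarith), mul_zero] at this
  obtain ⟨n, hn1, hn2, hn0⟩ := ((hlim.eventually (ge_mem_nhds one_pos)).and
    ((hlim'.eventually (ge_mem_nhds (show (0 : ℝ) < 1 / 2 by norm_num))).and
      (eventually_gt_atTop 0))).exists
  have hnT : n * (T / n) = T := by
    have : (n : ℝ) ≠ 0 := by positivity
    field_simp
  refine ⟨max 1 ((nextBound α B)^[n] B), by positivity, ?_⟩
  intro S hS ξ hξ f₀ hf₀ hf₀' f hf hf' Y Y' hY t ht
  have hS' : ∀ t ∈ Icc 0 T, ‖S.op t‖ ≤ B := fun t ht =>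
    calc ‖S.op t‖ ≤ M * Real.exp (ω * t) := hS t ht.1
      _ ≤ m := by
        rw [hm]
        gcongr
        · exact ht.1
        · exact le_abs_self ω
        · exact ht.2
      _ ≤ B := by linarith
  have hb := hY.isBoundedMild (B := B) hα hα' (by linarith) (by linarith) hC.le hC'.le
    (by linarith) (by linarith) (by linarith) (by linarith) hS' (by linarith) hf₀ hf₀' hf hf'
  have := (hb.bounds_iterate (by positivity) hn1 hn2 n hnT.le).1
  rw [hnT] at this
  exact (this t ht).trans (le_max_right _ _)

end
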